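/- Let $d\ge 2$, $a,b\in(0,\infty)$, and let $e_1$ be the first standard basis vector of $\mathbb R^d$ (with Euclidean norm $\|\cdot\|$). For $x\in\mathbb R^d\setminus\{0\}$ put $\hat x=x/\|x\|$, and put $\hat 0=e_1$. For each unit vector $u$ let $Q_u$ be an orthogonal $d\times d$ matrix with $Q_u e_1=u$, and let $D=\sqrt d\,\operatorname{diag}(a,b,\dots,b)$. Let $X=(X_n)_{n\ge 0}$ be an elliptic random walk on $\mathbb R^d$, that is, a process started from a fixed point $X_0=x_0\in\mathbb R^d$ such that, for every $n\ge 0$, the conditional law of the increment $X_{n+1}-X_n$ given $X_0,\dots,X_n$ is the law of $Q_{\hat x}D\zeta$ evaluated at $x=X_n$, where $\zeta$ is uniformly distributed on the unit sphere of $\mathbb R^d$. Then: (i) if $a^2<(d-1)b^2$, then $X$ is transient: $\lim_{n\to\infty}\|X_n\|=\infty$ almost surely; (ii) if $a^2\ge(d-1)b^2$, then $X$ is null-recurrent: there is a constant $r_0\in[0,\infty)$ such that $\liminf_{n\to\infty}\|X_n\|\le r_0$ almost surely (recurrence), and for every bounded $A\subset\mathbb R^d$, $$\lim_{n\to\infty}\frac1n\sum_{k=0}^{n-1}\mathbf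 1\{X_k\in A\}=0\quad\text{almost surely and in }L^q\text{ for every }q\in[1,\infty)\quad\text{(nullity)}.$$ -/

import Mathlib

open MeasureTheory ProbabilityTheory Filter Topology
open scoped ENNReal NNReal

noncomputable section

namespace EllipticWalk

/-- `ℝ^d` with the Euclidean norm. -/
abbrev Vec (d : ℕ) : Type := EuclideanSpace ℝ (Fin d)

/-- The first standard basis vector (coordinates are numbered from `0`). -/
def e₁ (d : ℕ) : Vec d := WithLp.toLp 2 fun i => if (i : ℕ) = 0 then 1 else 0

/-- The direction `x / ‖x‖` of `x`, with the convention that the direction of `0` is `e₁`. -/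
def direction {d : ℕ} (x : Vec d) : Vec d := if x = 0 then e₁ d else ‖x‖⁻¹ • x

/-- The uniform distribution on the unit sphere: normalised surface measure. -/
def uniformSphere (d : ℕ) : Measure (Metric.sphere (0 : Vec d) 1) :=
  ((volume : Measure (Vec d)).toSphere Set.univ)⁻¹ • (volume : Measure (Vec d)).toSphere

/-- The matrix `D = √d · diag(a, b, …, b)`. -/
def axesMatrix (d : ℕ) (a b : ℝ) : Matrix (Fin d) (Fin d) ℝ :=
  √(d : ℝ) • Matrix.diagonal fun i : Fin d => if (i : ℕ) = 0 then a else b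

/-- `Q` assigns to every unit vector `u` an orthogonal matrix `Q u` that maps `e₁` to `u`
(no regularity in `u` is required). -/
def IsFrame {d : ℕ} (Q : Vec d → Matrix (Fin d) (Fin d) ℝ) : Prop :=
  ∀ u : Vec d, ‖u‖ = 1 →
    Q u ∈ Matrix.orthogonalGroup (Fin d) ℝ ∧ Matrix.toEuclideanLin (Q u) (e₁ d) = u

/-- The law of the increment at position `x`, that is of `Q_{x̂} D ζ` with `ζ` uniform on the
unit sphere. -/
def incrementLaw {d : ℕ} (a b : ℝ) (Q : Vec d → Matrix (Fin d) (Fin d) ℝ) (x : Vec d) :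
    Measure (Vec d) :=
  (uniformSphere d).map fun ζ : Metric.sphere (0 : Vec d) 1 =>
    Matrix.toEuclideanLin (Q (direction x) * axesMatrix d a b) (ζ : Vec d)

/-- `X` is an elliptic random walk with parameters `a, b` started from `x₀`: given
`X 0, …, X n`, the increment `X (n + 1) - X n` has the law `incrementLaw a b Q (X n)`. -/
structure IsEllipticWalk {Ω : Type*} [MeasurableSpace Ω] (P : Measure Ω) {d : ℕ} (a b : ℝ)
    (Q : Vec d → Matrix (Fin d) (Fin d) ℝ) (x₀ : Vec d) (X : ℕ → Ω → Vec d) : Prop where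
  measurable : ∀ n, Measurable (X n)
  start : ∀ᵐ ω ∂P, X 0 ω = x₀
  increment : ∀ (n : ℕ) (B : Set (Vec d)), MeasurableSet B →
    P⟦(fun ω => X (n + 1) ω - X n ω) ⁻¹' B |
        Filtration.natural X (fun k => (measurable k).stronglyMeasurable) n⟧
      =ᵐ[P] fun ω => (incrementLaw a b Q (X n ω)).real B

/-- Transience: `‖X n‖ → ∞` almost surely. -/
def IsTransient {Ω : Type*} [MeasurableSpace Ω] (P : Measure Ω) {d : ℕ}
    (X : ℕ → Ω → Vec d) : Prop :=
  ∀ᵐ ω ∂P, Tendsto (fun n => ‖X n ω‖) atTop atTop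

/-- Recurrence: `liminf ‖X n‖ ≤ r₀` almost surely for some constant `r₀ ∈ [0, ∞)`. The lower
limit is taken in `[0, ∞]`. -/
def IsRecurrent {Ω : Type*} [MeasurableSpace Ω] (P : Measure Ω) {d : ℕ}
    (X : ℕ → Ω → Vec d) : Prop :=
  ∃ r₀ : ℝ≥0, ∀ᵐ ω ∂P, liminf (fun n => ‖X n ω‖ₑ) atTop ≤ (r₀ : ℝ≥0∞)

/-- The proportion of the times `0, …, n - 1` at which the walk is in `A`. -/
def occupation {Ω : Type*} {d : ℕ} (X : ℕ → Ω → Vec d) (A : Set (Vec d)) (n : ℕ) (ω : Ω) : ℝ :=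
  (1 / (n : ℝ)) * ∑ k ∈ Finset.range n, A.indicator (fun _ => (1 : ℝ)) (X k ω)

/-- Nullity: the proportion of time spent in any bounded set tends to `0` almost surely and in
`L^q` for every (finite) `q ≥ 1`. -/
def IsNull {Ω : Type*} [MeasurableSpace Ω] (P : Measure Ω) {d : ℕ}
    (X : ℕ → Ω → Vec d) : Prop :=
  ∀ A : Set (Vec d), Bornology.IsBounded A →
    (∀ᵐ ω ∂P, Tendsto (fun n => occupation X A n ω) atTop (𝓝 0)) ∧
    ∀ q : ℝ, 1 ≤ q →
      Tendsto (fun n => eLpNorm (occupation X A n) (ENNReal.ofReal q) P) atTop (𝓝 0)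

/-- Null-recurrence: recurrent and null. -/
def IsNullRecurrent {Ω : Type*} [MeasurableSpace Ω] (P : Measure Ω) {d : ℕ}
    (X : ℕ → Ω → Vec d) : Prop :=
  IsRecurrent P X ∧ IsNull P X

end EllipticWalk

end

/-!
The distance `R n = ‖X n‖` is itself a Markov chain: from `r` it moves to
`√((r + p s) ^ 2 + q ^ 2 (1 - s ^ 2))`, where `p = √d a`, `q = √d b` and `s` is one coordinate of a
uniform point of the sphere, a symmetric variable with second moment `v = 1 / d`.

If `q ^ 2 (1 - v) ≤ p ^ 2 v`, that is `(d - 1) b ^ 2 ≤ a ^ 2`, then for a suitable constant `c` the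
function `log (r ^ 2 - c)` does not increase in mean far from the origin: pairing `s` with `-s`
turns its expectation into that of the logarithm of a product, to which `log x ≤ x - 1` applies. As
this function tends to infinity, the chain returns.

In the opposite case the logarithm has a positive drift and `r ^ (-κ)` a negative one for small
`κ > 0`, so that `r ^ (-κ)` converges along the chain, to `0` because the chain is unbounded.

In both cases `E ‖X n‖` is `O(√n)`, while it never decreases and every visit to a ball raises it by
at least a fixed amount. Hence the expected number of visits up to time `n` is `O(√n)`, and
summing along a polynomial subsequence gives nullity.
-/

namespace EllipticWalk

/-! ### Markov chains and Lyapunov functions -/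

section MarkovChain

variable {Ω α : Type*} {m : MeasurableSpace Ω} [mΩ : MeasurableSpace Ω]
  [MeasurableSpace α] {P : Measure Ω} {ℱ : Filtration ℕ mΩ} {κ : Kernel α α} {X : ℕ → Ω → α}

/-- `X` is a time-homogeneous Markov chain with transition kernel `κ` with respect to the
filtration `ℱ`. Conditioning on `ℱ n` is expressed by restricting `P` to the events of `ℱ n`. -/
structure IsMarkovChain (P : Measure Ω) (ℱ : Filtration ℕ mΩ) (κ : Kernel α α)
    (X : ℕ → Ω → α) : Prop where
  adapted : ∀ n, Measurable[ℱ n] (X n)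
  hasCondDistrib_succ : ∀ (n : ℕ) (E : Set Ω), MeasurableSet[ℱ n] E →
    HasCondDistrib (X (n + 1)) (X n) κ (P.restrict E)

lemma restrict_apply_preimage_of_condExp_ae_eq [IsFiniteMeasure P] {β : Type*}
    [MeasurableSpace β] (hm : m ≤ mΩ) {Y : Ω → β} (hY : Measurable Y)
    {ν : Ω → Measure β} [∀ ω, IsFiniteMeasure (ν ω)] {B : Set β} (hB : MeasurableSet B)
    (h : P⟦Y ⁻¹' B | m⟧ =ᵐ[P] fun ω => (ν ω).real B) {E : Set Ω} (hE : MeasurableSet[m] E) :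
    P.restrict E (Y ⁻¹' B) = ∫⁻ ω in E, ν ω B ∂P := by
  have h_integral : ∫ ω in E, (ν ω).real B ∂P = (P.restrict E).real (Y ⁻¹' B) := by
    rw [← setIntegral_congr_ae (hm _ hE) (h.mono fun ω hω _ => hω),
      setIntegral_condExp hm ((integrable_const _).indicator (hY hB)) hE,
      integral_indicator (hY hB), setIntegral_const, smul_eq_mul, mul_one]
  have h_int : IntegrableOn (fun ω => (ν ω).real B) E P :=
    (integrable_condExp.congr h).integrableOn
  rw [← ofReal_measureReal, ← h_integral, ofReal_integral_eq_lintegral_ofReal h_int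
    (ae_of_all _ fun ω => measureReal_nonneg)]
  exact lintegral_congr fun ω => ofReal_measureReal

lemma hasCondDistrib_restrict_of_condExp_ae_eq [IsFiniteMeasure P] {β : Type*}
    [MeasurableSpace β] (hm : m ≤ mΩ) {X : Ω → α} (hX : Measurable[m] X)
    {Y : Ω → β} (hY : Measurable Y) {η : Kernel α β} [IsMarkovKernel η]
    (h : ∀ B, MeasurableSet B → P⟦Y ⁻¹' B | m⟧ =ᵐ[P] fun ω => (η (X ω)).real B)
    {E : Set Ω} (hE : MeasurableSet[m] E) : HasCondDistrib Y X η (P.restrict E) := by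
  have hX' : Measurable X := hX.mono hm le_rfl
  refine ⟨by fun_prop, Measure.ext_prod fun {A B} hA hB => ?_⟩
  rw [Measure.map_apply (hX'.prodMk hY) (hA.prod hB), Measure.compProd_apply_prod hA hB,
    setLIntegral_map hA (η.measurable_coe hB) hX', Measure.restrict_restrict (hX' hA),
    ← restrict_apply_preimage_of_condExp_ae_eq hm hY hB (h B hB) ((hX hA).inter hE),
    Set.mk_preimage_prod, Measure.restrict_apply (hY hB),
    Measure.restrict_apply ((hX' hA).inter (hY hB))]
  congr 1
  ac_rfl

lemma hasCondDistrib_comp_prodMk {β γ : Type*} [MeasurableSpace β] [MeasurableSpace γ]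
    [SFinite P] {X : Ω → α} {Y : Ω → β} {η : Kernel α β} [IsSFiniteKernel η]
    (h : HasCondDistrib Y X η P) {f : α × β → γ} (hf : Measurable f) :
    HasCondDistrib (fun ω => f (X ω, Y ω)) X ((Kernel.id ×ₖ η).map f) P := by
  have hX : AEMeasurable X P := h.aemeasurable_fst
  have hY : AEMeasurable Y P := h.aemeasurable_snd
  have hg : Measurable fun z : α × β => (z.1, f z) := measurable_fst.prodMk hf
  refine ⟨hX.prodMk (hf.comp_aemeasurable (hX.prodMk hY)), ?_⟩
  calc P.map (fun ω => (X ω, f (X ω, Y ω)))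
      = (P.map X ⊗ₘ η).map fun z => (z.1, f z) := by
        rw [← h.map_eq, AEMeasurable.map_map_of_aemeasurable hg.aemeasurable (hX.prodMk hY)]
        rfl
    _ = P.map X ⊗ₘ (Kernel.id ×ₖ η).map f := by
        ext B hB
        rw [Measure.map_apply hg hB, Measure.compProd_apply (hg hB), Measure.compProd_apply hB]
        refine lintegral_congr fun x => ?_
        have hBx : MeasurableSet (f ⁻¹' (Prod.mk x ⁻¹' B)) := hf (measurable_prodMk_left hB)
        rw [Kernel.map_apply' _ hf _ (measurable_prodMk_left hB), Kernel.prod_apply,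
          Kernel.id_apply, Measure.dirac_prod, Measure.map_apply measurable_prodMk_left hBx]
        rfl

lemma isMarkovChain_of_condExp_increment {E : Type*} [AddCommGroup E] [MeasurableSpace E]
    [MeasurableAdd₂ E] [MeasurableSub₂ E] [IsFiniteMeasure P] {X : ℕ → Ω → E}
    {η : Kernel E E} [IsMarkovKernel η] (hX : ∀ n, Measurable[ℱ n] (X n))
    (h : ∀ n B, MeasurableSet B → P⟦(fun ω => X (n + 1) ω - X n ω) ⁻¹' B | ℱ n⟧
      =ᵐ[P] fun ω => (η (X n ω)).real B) :
    IsMarkovChain P ℱ ((Kernel.id ×ₖ η).map fun z => z.1 + z.2) X := by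
  refine ⟨hX, fun n F hF => ?_⟩
  have hX' n : Measurable (X n) := (hX n).mono (ℱ.le n) le_rfl
  have h_increment := hasCondDistrib_restrict_of_condExp_ae_eq (ℱ.le n) (hX n)
    ((hX' (n + 1)).sub (hX' n)) (h n) hF
  simpa using hasCondDistrib_comp_prodMk h_increment (f := fun z => z.1 + z.2) (by fun_prop)

namespace IsMarkovChain

lemma measurable (hX : IsMarkovChain P ℱ κ X) (n : ℕ) : Measurable (X n) :=
  (hX.adapted n).mono (ℱ.le n) le_rfl

lemma shift (hX : IsMarkovChain P ℱ κ X) (k : ℕ) :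
    IsMarkovChain P ⟨fun n => ℱ (k + n), fun _ _ h => ℱ.mono (by omega), fun _ => ℱ.le _⟩ κ
      fun n => X (k + n) :=
  ⟨fun n => hX.adapted (k + n), fun n => hX.hasCondDistrib_succ (k + n)⟩

lemma ae_succ_of_ae {p p' : α → Prop} (hX : IsMarkovChain P ℱ κ X) {n : ℕ}
    (hn : ∀ᵐ ω ∂P, p (X n ω)) (hp : MeasurableSet {x | p x}) (hp' : MeasurableSet {x | p' x})
    (h : ∀ x, p x → ∀ᵐ y ∂κ x, p' y) : ∀ᵐ ω ∂P, p' (X (n + 1) ω) := by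
  have h_law := hX.hasCondDistrib_succ n Set.univ MeasurableSet.univ
  rw [Measure.restrict_univ] at h_law
  have h_ae : ∀ᵐ z ∂(P.map (X n) ⊗ₘ κ), p' z.2 :=
    Measure.ae_compProd_of_ae_ae (measurable_snd hp')
      (((ae_map_iff (hX.measurable n).aemeasurable hp).2 hn).mono h)
  exact (h_law.ae_iff (measurableSet_setOfPred.1 (measurable_snd hp'))).2 h_ae

lemma integrable_compProd (hX : IsMarkovChain P ℱ κ X) {V : α → ℝ} (hV : Measurable V) {n : ℕ}
    (h_int : Integrable (fun ω => V (X (n + 1) ω)) P) {E : Set Ω} (hE : MeasurableSet[ℱ n] E) :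
    Integrable (fun z : α × α => V z.2) ((P.restrict E).map (X n) ⊗ₘ κ) := by
  have h_law := hX.hasCondDistrib_succ n E hE
  have hV2 : Measurable fun z : α × α => V z.2 := hV.comp measurable_snd
  rw [← h_law.map_eq, integrable_map_measure hV2.aestronglyMeasurable h_law.aemeasurable]
  exact h_int.integrableOn

variable [IsFiniteMeasure P] [IsMarkovKernel κ]

lemma setIntegral_succ (hX : IsMarkovChain P ℱ κ X) {V : α → ℝ} (hV : Measurable V) {n : ℕ}
    (h_int : Integrable (fun ω => V (X (n + 1) ω)) P) {E : Set Ω} (hE : MeasurableSet[ℱ n] E) :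
    ∫ ω in E, V (X (n + 1) ω) ∂P = ∫ ω in E, ∫ y, V y ∂κ (X n ω) ∂P := by
  have h_law := hX.hasCondDistrib_succ n E hE
  have hV2 : Measurable fun z : α × α => V z.2 := hV.comp measurable_snd
  have h_inner : StronglyMeasurable fun x => ∫ y, V y ∂κ x :=
    hV.stronglyMeasurable.integral_kernel
  calc ∫ ω in E, V (X (n + 1) ω) ∂P
      = ∫ z, V z.2 ∂((P.restrict E).map (X n) ⊗ₘ κ) := by
        rw [← h_law.map_eq, integral_map h_law.aemeasurable hV2.aestronglyMeasurable]
    _ = ∫ ω in E, ∫ y, V y ∂κ (X n ω) ∂P := by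
        rw [Measure.integral_compProd (hX.integrable_compProd hV h_int hE),
          integral_map (hX.measurable n).aemeasurable h_inner.aestronglyMeasurable]

lemma integrable_integral_succ (hX : IsMarkovChain P ℱ κ X) {V : α → ℝ} (hV : Measurable V)
    {n : ℕ} (h_int : Integrable (fun ω => V (X (n + 1) ω)) P) :
    Integrable (fun ω => ∫ y, V y ∂κ (X n ω)) P := by
  have h_comp := (hX.integrable_compProd hV h_int MeasurableSet.univ).integral_compProd
  rw [Measure.restrict_univ] at h_comp
  exact h_comp.comp_measurable (hX.measurable n)

lemma integral_succ (hX : IsMarkovChain P ℱ κ X) {V : α → ℝ} (hV : Measurable V) {n : ℕ}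
    (h_int : Integrable (fun ω => V (X (n + 1) ω)) P) :
    ∫ ω, V (X (n + 1) ω) ∂P = ∫ ω, ∫ y, V y ∂κ (X n ω) ∂P := by
  simpa using hX.setIntegral_succ hV h_int MeasurableSet.univ

end IsMarkovChain

end MarkovChain

section Lyapunov

variable {Ω α : Type*} [mΩ : MeasurableSpace Ω] [MeasurableSpace α] {P : Measure Ω}
  {ℱ : Filtration ℕ mΩ} {κ : Kernel α α} {X : ℕ → Ω → α} [IsFiniteMeasure P]

lemma ae_exists_tendsto_of_supermartingale_of_nonneg {Y : ℕ → Ω → ℝ}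
    (hY : Supermartingale Y ℱ P) (hY_nonneg : ∀ n ω, 0 ≤ Y n ω) :
    ∀ᵐ ω ∂P, ∃ c, Tendsto (fun n => Y n ω) atTop (𝓝 c) := by
  have h_bdd : ∀ n, eLpNorm ((-Y) n) 1 P ≤ (∫ ω, Y 0 ω ∂P).toNNReal := by
    intro n
    rw [Pi.neg_apply, eLpNorm_neg, eLpNorm_one_eq_lintegral_enorm]
    simp only [Real.enorm_of_nonneg (hY_nonneg n _)]
    rw [← ofReal_integral_eq_lintegral_ofReal (hY.integrable n) (ae_of_all _ (hY_nonneg n))]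
    refine ENNReal.ofReal_le_ofReal ?_
    simpa using hY.setIntegral_le (Nat.zero_le n) MeasurableSet.univ
  filter_upwards [hY.neg.exists_ae_tendsto_of_bdd h_bdd] with ω ⟨c, hc⟩
  exact ⟨-c, by simpa using hc.neg⟩

namespace IsMarkovChain

variable [IsMarkovKernel κ] {V : α → ℝ} {S : Set α}

lemma supermartingale_indicator_forall_mem (hX : IsMarkovChain P ℱ κ X) (hV : Measurable V)
    (hV_nonneg : ∀ x, 0 ≤ V x) (h_int : ∀ n, Integrable (fun ω => V (X n ω)) P)
    (hS : MeasurableSet S) (h_drift : ∀ x ∈ S, ∫ y, V y ∂κ x ≤ V x) :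
    Supermartingale (fun n => {ω | ∀ j ≤ n, X j ω ∈ S}.indicator fun ω => V (X n ω)) ℱ P := by
  have h_stay n : MeasurableSet[ℱ n] {ω | ∀ j ≤ n, X j ω ∈ S} := by
    simp only [Set.ofPred_forall]
    exact .iInter fun j => .iInter fun hj => ℱ.mono hj _ (hX.adapted j hS)
  refine supermartingale_of_setIntegral_succ_le
    (fun n => ((hV.comp (hX.adapted n)).indicator (h_stay n)).stronglyMeasurable)
    (fun n => (h_int n).indicator (ℱ.le n _ (h_stay n))) fun n E hE => ?_
  set A : ℕ → Set Ω := fun n => {ω | ∀ j ≤ n, X j ω ∈ S}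
  have hA : A (n + 1) ⊆ A n := fun ω hω j hj => hω j (by omega)
  have hA_meas k : MeasurableSet (A k) := ℱ.le k _ (h_stay k)
  have hEA : MeasurableSet[ℱ n] (E ∩ A n) := hE.inter (h_stay n)
  calc ∫ ω in E, (A (n + 1)).indicator (fun ω => V (X (n + 1) ω)) ω ∂P
      ≤ ∫ ω in E, (A n).indicator (fun ω => V (X (n + 1) ω)) ω ∂P :=
        setIntegral_mono ((h_int _).indicator (hA_meas _)).integrableOn
          ((h_int _).indicator (hA_meas _)).integrableOn
          (Set.indicator_le_indicator_of_subset hA fun ω => hV_nonneg _)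
    _ = ∫ ω in E ∩ A n, ∫ y, V y ∂κ (X n ω) ∂P := by
        rw [setIntegral_indicator (hA_meas n), hX.setIntegral_succ hV (h_int _) hEA]
    _ ≤ ∫ ω in E ∩ A n, V (X n ω) ∂P :=
        integral_mono_of_nonneg (ae_of_all _ fun ω => integral_nonneg hV_nonneg)
          (h_int n).integrableOn
          ((ae_restrict_mem (ℱ.le n _ hEA)).mono fun ω hω => h_drift _ (hω.2 n le_rfl))
    _ = ∫ ω in E, (A n).indicator (fun ω => V (X n ω)) ω ∂P :=
        (setIntegral_indicator (hA_meas n)).symm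

theorem ae_frequently_notMem_or_exists_tendsto (hX : IsMarkovChain P ℱ κ X)
    (hV : Measurable V) (hV_nonneg : ∀ x, 0 ≤ V x)
    (h_int : ∀ n, Integrable (fun ω => V (X n ω)) P) (hS : MeasurableSet S)
    (h_drift : ∀ x ∈ S, ∫ y, V y ∂κ x ≤ V x) :
    ∀ᵐ ω ∂P, (∃ᶠ n in atTop, X n ω ∉ S) ∨
      ∃ c, Tendsto (fun n => V (X n ω)) atTop (𝓝 c) := by
  have h_tendsto k := ae_exists_tendsto_of_supermartingale_of_nonneg
    ((hX.shift k).supermartingale_indicator_forall_mem hV hV_nonneg (fun n => h_int (k + n)) hS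
      h_drift) fun n ω => Set.indicator_nonneg (fun ω _ => hV_nonneg _) ω
  filter_upwards [ae_all_iff.2 h_tendsto] with ω hω
  refine or_iff_not_imp_left.2 fun h_mem => ?_
  simp only [not_frequently, not_not, eventually_atTop] at h_mem
  obtain ⟨k, hk⟩ := h_mem
  obtain ⟨c, hc⟩ := hω k
  refine ⟨c, (tendsto_add_atTop_iff_nat k).1 (hc.congr fun n => ?_)⟩
  have h_stay : ω ∈ {ω | ∀ j ≤ n, X (k + j) ω ∈ S} := fun j _ => hk (k + j) (by omega)
  rw [Set.indicator_of_mem h_stay, add_comm]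

end IsMarkovChain

end Lyapunov

section TimeAverage

variable {Ω : Type*} [MeasurableSpace Ω] {P : Measure Ω}

lemma eventually_succ_pow_le_mul_pow {a : ℝ} (ha : 1 < a) (k : ℕ) :
    ∀ᶠ n : ℕ in atTop, ((n + 1 : ℕ) : ℝ) ^ k ≤ a * (n : ℝ) ^ k := by
  have h_ratio : Tendsto (fun n : ℕ => ((n : ℝ) / (n + 1)) ^ k) atTop (𝓝 1) := by
    simpa using (tendsto_natCast_div_add_atTop (1 : ℝ)).pow k
  filter_upwards [h_ratio.eventually_const_lt (inv_lt_one_of_one_lt₀ ha)] with n hn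
  rw [div_pow, lt_div_iff₀ (by positivity), inv_mul_lt_iff₀ (by linarith)] at hn
  exact_mod_cast hn.le

lemma ae_summable_of_summable_integral {f : ℕ → Ω → ℝ} (hf : ∀ n, Integrable (f n) P)
    (hf_nonneg : ∀ n, 0 ≤ f n) (h_sum : Summable fun n => ∫ ω, f n ω ∂P) :
    ∀ᵐ ω ∂P, Summable fun n => f n ω := by
  have h_norm n : eLpNorm (f n) 1 P = ENNReal.ofReal (∫ ω, f n ω ∂P) := by
    rw [eLpNorm_one_eq_lintegral_enorm,
      ofReal_integral_eq_lintegral_ofReal (hf n) (ae_of_all _ (hf_nonneg n))]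
    exact lintegral_congr fun ω => Real.enorm_of_nonneg (hf_nonneg n ω)
  filter_upwards [summable_norm_of_tsum_eLpNorm_ne_top le_rfl
    (fun n => (hf n).aestronglyMeasurable) (by simpa only [h_norm] using h_sum.tsum_ofReal_ne_top)]
    with ω hω using hω.of_norm

theorem ae_tendsto_div_of_integral_isBigO_sqrt {S : ℕ → Ω → ℝ}
    (h_int : ∀ n, Integrable (S n) P) (h_nonneg : ∀ n, 0 ≤ S n)
    (h_mono : ∀ ω, Monotone fun n => S n ω)
    (h_bigO : (fun n => ∫ ω, S n ω ∂P) =O[atTop] fun n : ℕ => √(n : ℝ)) :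
    ∀ᵐ ω ∂P, Tendsto (fun n : ℕ => S n ω / n) atTop (𝓝 0) := by
  have h_pow : Tendsto (fun n : ℕ => n ^ 4) atTop atTop := tendsto_pow_atTop (by norm_num)
  have h_sum : Summable fun n : ℕ => ∫ ω, S (n ^ 4) ω / (n ^ 4 : ℕ) ∂P := by
    refine summable_of_isBigO_nat (Real.summable_nat_pow_inv.2 one_lt_two) ?_
    have h_mul := (h_bigO.comp_tendsto h_pow).mul
      (Asymptotics.isBigO_refl (fun n : ℕ => ((n ^ 4 : ℕ) : ℝ)⁻¹) atTop)
    refine (h_mul.congr_left fun n => (integral_div _ _).symm).congr_right fun n => ?_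
    have h_sqrt : √((n ^ 4 : ℕ) : ℝ) = (n : ℝ) ^ 2 := by
      rw [Nat.cast_pow, pow_mul' (n : ℝ) 2 2, Real.sqrt_sq (by positivity)]
    rcases eq_or_ne n 0 with rfl | hn
    · simp
    · rw [Function.comp_apply, h_sqrt]
      push_cast
      field_simp
  filter_upwards [ae_summable_of_summable_integral (fun n => (h_int (n ^ 4)).div_const _)
    (fun n ω => div_nonneg (h_nonneg _ ω) (Nat.cast_nonneg _)) h_sum] with ω hω
  refine tendsto_div_of_monotone_of_exists_subseq_tendsto_div _ _ (h_mono ω) fun a ha =>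
    ⟨fun n => n ^ 4, ?_, h_pow, hω.tendsto_atTop_zero⟩
  exact_mod_cast eventually_succ_pow_le_mul_pow ha 4

end TimeAverage

/-! ### The radial drift -/

section RadialStep

/-- The distance from the origin after a step of the walk from distance `r`, if the step has
semi-axes `p` (radially) and `q` (across) and the uniform point of the sphere has radial
coordinate `s`. -/
noncomputable def radialStep (p q r s : ℝ) : ℝ := √((r + p * s) ^ 2 + q ^ 2 * (1 - s ^ 2))

variable {p q r s : ℝ}

@[fun_prop]
lemma continuous_radialStep (p q r : ℝ) : Continuous (radialStep p q r) := by
  unfold radialStep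
  fun_prop

lemma radialStep_nonneg (p q r s : ℝ) : 0 ≤ radialStep p q r s := Real.sqrt_nonneg _

lemma sq_le_one_of_mem_Icc (hs : s ∈ Set.Icc (-1) 1) : s ^ 2 ≤ 1 :=
  (sq_le_one_iff_abs_le_one s).2 (abs_le.2 hs)

lemma sq_mul_one_sub_sq_nonneg (q : ℝ) (hs : s ∈ Set.Icc (-1) 1) : 0 ≤ q ^ 2 * (1 - s ^ 2) :=
  mul_nonneg (sq_nonneg q) (sub_nonneg.2 (sq_le_one_of_mem_Icc hs))

lemma sq_radialStep (p q r : ℝ) (hs : s ∈ Set.Icc (-1) 1) :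
    radialStep p q r s ^ 2 = (r + p * s) ^ 2 + q ^ 2 * (1 - s ^ 2) :=
  Real.sq_sqrt (add_nonneg (sq_nonneg _) (sq_mul_one_sub_sq_nonneg q hs))

lemma add_mul_le_radialStep (p q r : ℝ) (hs : s ∈ Set.Icc (-1) 1) :
    r + p * s ≤ radialStep p q r s :=
  Real.le_sqrt_of_sq_le (le_add_of_nonneg_right (sq_mul_one_sub_sq_nonneg q hs))

lemma sub_le_radialStep (hp : 0 ≤ p) (hs : s ∈ Set.Icc (-1) 1) :
    r - p ≤ radialStep p q r s := by
  have h_mul : -p ≤ p * s := by nlinarith [hs.1]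
  linarith [add_mul_le_radialStep p q r hs]

lemma radialStep_le (hp : 0 ≤ p) (hq : 0 ≤ q) (hr : 0 ≤ r) (hs : s ∈ Set.Icc (-1) 1) :
    radialStep p q r s ≤ r + (p + q) := by
  refine Real.sqrt_le_iff.2 ⟨by positivity, ?_⟩
  have h_sq : p ^ 2 * s ^ 2 ≤ p ^ 2 :=
    mul_le_of_le_one_right (sq_nonneg p) (sq_le_one_of_mem_Icc hs)
  nlinarith [mul_nonneg hr hq, mul_nonneg hp hq, mul_nonneg (mul_nonneg hr hp)
    (sub_nonneg.2 hs.2), mul_nonneg (sq_nonneg q) (sq_nonneg s)]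

lemma neg_mem_Icc (hs : s ∈ Set.Icc (-1) 1) : -s ∈ Set.Icc (-1 : ℝ) 1 :=
  ⟨neg_le_neg hs.2, neg_le.1 hs.1⟩

lemma sq_radialStep_sub_mul_sq_radialStep_neg_sub (p q r c : ℝ) (hs : s ∈ Set.Icc (-1) 1) :
    (radialStep p q r s ^ 2 - c) * (radialStep p q r (-s) ^ 2 - c) =
      (r ^ 2 - c + (p ^ 2 * s ^ 2 + q ^ 2 * (1 - s ^ 2))) ^ 2 - 4 * r ^ 2 * p ^ 2 * s ^ 2 := by
  rw [sq_radialStep p q r hs, sq_radialStep p q r (neg_mem_Icc hs)]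
  ring

end RadialStep

/-- A symmetric probability measure on `[-1, 1]` with second moment `v`, the law of the radial
coordinate `s` in `radialStep p q r s`. -/
structure IsNoise (μ : Measure ℝ) (v : ℝ) : Prop where
  isProbabilityMeasure : IsProbabilityMeasure μ
  isNegInvariant : μ.IsNegInvariant
  ae_mem_Icc : ∀ᵐ s ∂μ, s ∈ Set.Icc (-1) 1
  integral_sq : ∫ s, s ^ 2 ∂μ = v

namespace IsNoise

variable {μ : Measure ℝ} {v p q r : ℝ}

lemma integrable_of_continuousOn (hμ : IsNoise μ v) {f : ℝ → ℝ}
    (hf : ContinuousOn f (Set.Icc (-1) 1)) : Integrable f μ := by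
  have := hμ.isProbabilityMeasure
  rw [← Measure.restrict_eq_self_of_ae_mem hμ.ae_mem_Icc]
  exact hf.integrableOn_compact isCompact_Icc

lemma integrable_radialStep (hμ : IsNoise μ v) (p q r : ℝ) :
    Integrable (radialStep p q r) μ :=
  hμ.integrable_of_continuousOn (continuous_radialStep p q r).continuousOn

lemma integral_quadratic (hμ : IsNoise μ v) (c₀ c₁ : ℝ) :
    ∫ s, (c₀ + c₁ * s ^ 2) ∂μ = c₀ + c₁ * v := by
  have := hμ.isProbabilityMeasure
  rw [integral_add (integrable_const _) (hμ.integrable_of_continuousOn (by fun_prop)),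
    integral_const_mul, hμ.integral_sq]
  simp

lemma integral_le (hμ : IsNoise μ v) {f : ℝ → ℝ} (hf : Integrable f μ) (c₀ c₁ : ℝ)
    (h : ∀ s ∈ Set.Icc (-1) 1, f s + f (-s) ≤ 2 * (c₀ + c₁ * s ^ 2)) :
    ∫ s, f s ∂μ ≤ c₀ + c₁ * v := by
  have := hμ.isNegInvariant
  have h_sum : ∫ s, (f s + f (-s)) ∂μ ≤ ∫ s, 2 * (c₀ + c₁ * s ^ 2) ∂μ :=
    integral_mono_ae (hf.add hf.comp_neg) (hμ.integrable_of_continuousOn (by fun_prop))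
      (hμ.ae_mem_Icc.mono h)
  rw [integral_add hf hf.comp_neg, integral_neg_eq_self, integral_const_mul,
    hμ.integral_quadratic] at h_sum
  linarith

lemma le_integral (hμ : IsNoise μ v) {f : ℝ → ℝ} (hf : Integrable f μ) (c₀ c₁ : ℝ)
    (h : ∀ s ∈ Set.Icc (-1) 1, 2 * (c₀ + c₁ * s ^ 2) ≤ f s + f (-s)) :
    c₀ + c₁ * v ≤ ∫ s, f s ∂μ := by
  have h_neg := hμ.integral_le hf.neg (-c₀) (-c₁) fun s hs => by
    simp only [Pi.neg_apply]
    linarith [h s hs]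
  simp only [Pi.neg_apply, integral_neg] at h_neg
  linarith

lemma integral_sq_radialStep_le (hμ : IsNoise μ v) (p q r : ℝ) :
    ∫ s, radialStep p q r s ^ 2 ∂μ ≤ r ^ 2 + (p ^ 2 * v + q ^ 2 * (1 - v)) := by
  refine (hμ.integral_le (hμ.integrable_of_continuousOn (by fun_prop)) (r ^ 2 + q ^ 2)
    (p ^ 2 - q ^ 2) fun s hs => ?_).trans_eq (by ring)
  rw [sq_radialStep p q r hs, sq_radialStep p q r (neg_mem_Icc hs)]
  exact le_of_eq (by ring)

lemma le_integral_radialStep (hμ : IsNoise μ v) (hp : 0 < p) (hq : 0 ≤ q) (hr : 0 ≤ r) :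
    r + q ^ 2 * (1 - v) / (2 * (r + (p + q))) ≤ ∫ s, radialStep p q r s ∂μ := by
  have h_step : ∀ s ∈ Set.Icc (-1) 1,
      r + p * s + q ^ 2 * (1 - s ^ 2) / (2 * (r + (p + q))) ≤ radialStep p q r s := by
    intro s hs
    have h_le := radialStep_le hp.le hq hr hs
    have h_ge := add_mul_le_radialStep p q r hs
    rw [← le_sub_iff_add_le', div_le_iff₀ (by positivity)]
    calc q ^ 2 * (1 - s ^ 2)
        = (radialStep p q r s - (r + p * s)) * (radialStep p q r s + (r + p * s)) := by
          linarith [sq_radialStep p q r hs]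
      _ ≤ (radialStep p q r s - (r + p * s)) * (2 * (r + (p + q))) :=
          mul_le_mul_of_nonneg_left (by linarith) (sub_nonneg.2 h_ge)
  refine Eq.trans_le (by ring) (hμ.le_integral (hμ.integrable_radialStep p q r)
    (r + q ^ 2 / (2 * (r + (p + q)))) (-(q ^ 2 / (2 * (r + (p + q))))) fun s hs => ?_)
  refine Eq.trans_le ?_ (add_le_add (h_step s hs) (h_step (-s) (neg_mem_Icc hs)))
  ring

end IsNoise

section LogDrift

variable {p q r s c : ℝ}

lemma log_add_log_le {x y V : ℝ} (hx : 0 < x) (hy : 0 < y) (hV : 0 < V) :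
    Real.log x + Real.log y ≤ 2 * Real.log V + (x * y / V ^ 2 - 1) := by
  have h_log := Real.log_le_sub_one_of_pos (show 0 < x * y / V ^ 2 by positivity)
  rw [Real.log_div (by positivity) (by positivity), Real.log_mul hx.ne' hy.ne', Real.log_pow]
    at h_log
  push_cast at h_log
  linarith

lemma sub_two_mul_sq_le_log_one_add {t : ℝ} (ht : -(1 / 2) ≤ t) :
    t - 2 * t ^ 2 ≤ Real.log (1 + t) := by
  have h_pos : 0 < 1 + t := by linarith
  refine le_trans ?_ (Real.one_sub_inv_le_log_of_pos h_pos)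
  rw [inv_eq_one_div, ← sub_nonneg]
  have h_eq : 1 - 1 / (1 + t) - (t - 2 * t ^ 2) = t ^ 2 * (1 + 2 * t) / (1 + t) := by
    field_simp
    ring
  rw [h_eq]
  exact div_nonneg (mul_nonneg (sq_nonneg t) (by linarith)) h_pos.le

lemma abs_log_one_add_le {t : ℝ} (ht : |t| ≤ 1 / 2) : |Real.log (1 + t)| ≤ 2 * |t| := by
  have h_neg := (abs_le.1 ht).1
  have h_le := Real.log_le_sub_one_of_pos (show 0 < 1 + t by linarith)
  have h_ge := sub_two_mul_sq_le_log_one_add h_neg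
  rw [abs_le]
  constructor <;> cases abs_cases t <;> nlinarith

lemma mul_sq_add_mul_one_sub_sq_mem_Icc (p q : ℝ) (hs : s ∈ Set.Icc (-1) 1) :
    p ^ 2 * s ^ 2 + q ^ 2 * (1 - s ^ 2) ∈ Set.Icc 0 (p ^ 2 + q ^ 2) := by
  have hp := sq_mul_one_sub_sq_nonneg p hs
  have hq := sq_mul_one_sub_sq_nonneg q hs
  exact ⟨by positivity, by nlinarith [mul_nonneg (sq_nonneg q) (sq_nonneg s)]⟩

lemma log_sq_radialStep_sub_add_le (hs : s ∈ Set.Icc (-1) 1) (hV : 0 < r ^ 2 - c)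
    (h_pos : 0 < radialStep p q r s ^ 2 - c) (h_neg : 0 < radialStep p q r (-s) ^ 2 - c) :
    Real.log (radialStep p q r s ^ 2 - c) + Real.log (radialStep p q r (-s) ^ 2 - c) ≤
      2 * (Real.log (r ^ 2 - c) + (q ^ 2 - (p ^ 2 + q ^ 2) * s ^ 2) / (r ^ 2 - c) +
        ((p ^ 2 + q ^ 2) ^ 2 - 4 * c * p ^ 2 * s ^ 2) / (2 * (r ^ 2 - c) ^ 2)) := by
  refine (log_add_log_le h_pos h_neg hV).trans ?_
  rw [sq_radialStep_sub_mul_sq_radialStep_neg_sub p q r c hs]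
  obtain ⟨hy, hyM⟩ := mul_sq_add_mul_one_sub_sq_mem_Icc p q hs
  have h_sq := pow_le_pow_left₀ hy hyM 2
  obtain ⟨V, hV_eq⟩ : ∃ V, V = r ^ 2 - c := ⟨_, rfl⟩
  rw [← hV_eq] at hV ⊢
  have hr : r ^ 2 = V + c := by linarith
  rw [hr, ← sub_nonneg]
  field_simp
  linarith

lemma le_log_radialStep_add (hr : 0 < r) (hr' : 4 * (p ^ 2 + q ^ 2) ≤ r ^ 2)
    (hs : s ∈ Set.Icc (-1) 1)
    (h_pos : 0 < radialStep p q r s) (h_neg : 0 < radialStep p q r (-s)) :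
    2 * (Real.log r + (q ^ 2 - (p ^ 2 + q ^ 2) * s ^ 2) / (2 * r ^ 2) -
        2 * (p ^ 2 + q ^ 2) ^ 2 / r ^ 4) ≤
      Real.log (radialStep p q r s) + Real.log (radialStep p q r (-s)) := by
  set M := p ^ 2 + q ^ 2 with hM
  set z := q ^ 2 - M * s ^ 2 with hz
  set w := 2 * z / r ^ 2 with hw
  have hz_abs : |z| ≤ M := by
    have := sq_le_one_of_mem_Icc hs
    rw [abs_le]
    constructor <;> nlinarith [sq_nonneg p, sq_nonneg q, sq_nonneg s]
  have hw_ge : -(1 / 2) ≤ w := by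
    rw [hw, le_div_iff₀ (by positivity)]
    linarith [(abs_le.1 hz_abs).1]
  have h_prod : r ^ 4 * (1 + w) ≤ (radialStep p q r s * radialStep p q r (-s)) ^ 2 := by
    have h_eq := sq_radialStep_sub_mul_sq_radialStep_neg_sub p q r 0 hs
    simp only [sub_zero] at h_eq
    rw [mul_pow, h_eq, hw, hz, hM]
    field_simp
    linarith [sq_nonneg (p ^ 2 * s ^ 2 + q ^ 2 * (1 - s ^ 2))]
  have h_log := Real.log_le_log (mul_pos (pow_pos hr 4) (by linarith)) h_prod
  rw [Real.log_mul (by positivity) (by linarith), Real.log_pow, Real.log_pow,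
    Real.log_mul h_pos.ne' h_neg.ne'] at h_log
  push_cast at h_log
  have h_sq : 2 * w ^ 2 ≤ 8 * (M ^ 2 / r ^ 4) := calc
    2 * w ^ 2 = 8 * (z ^ 2 / r ^ 4) := by
      rw [hw]
      ring
    _ ≤ 8 * (M ^ 2 / r ^ 4) := by
      gcongr 8 * (?_ / r ^ 4)
      exact sq_le_sq' (abs_le.1 hz_abs).1 (abs_le.1 hz_abs).2
  have hw_quarter : z / (2 * r ^ 2) = w / 4 := by
    rw [hw]
    ring
  rw [hw_quarter, mul_div_assoc]
  linarith [sub_two_mul_sq_le_log_one_add hw_ge]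

end LogDrift

lemma one_le_sq_radialStep_sub {p q r c s : ℝ} (hp : 0 ≤ p) (hc : 0 ≤ c) (hr : p + c + 1 ≤ r)
    (hs : s ∈ Set.Icc (-1) 1) : 1 ≤ radialStep p q r s ^ 2 - c := by
  have h_ge : c + 1 ≤ radialStep p q r s := by linarith [sub_le_radialStep (q := q) (r := r) hp hs]
  nlinarith

namespace IsNoise

variable {μ : Measure ℝ} {v p q r c : ℝ}

lemma integral_log_sq_radialStep_sub_le (hμ : IsNoise μ v) (hp : 0 ≤ p) (hc : 0 ≤ c)
    (hr : p + c + 1 ≤ r) :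
    ∫ s, Real.log (radialStep p q r s ^ 2 - c) ∂μ ≤
      Real.log (r ^ 2 - c) + (q ^ 2 * (1 - v) - p ^ 2 * v) / (r ^ 2 - c) +
        ((p ^ 2 + q ^ 2) ^ 2 - 4 * c * (p ^ 2 * v)) / (2 * (r ^ 2 - c) ^ 2) := by
  have hV : 0 < r ^ 2 - c := by nlinarith
  have h_pos : ∀ s ∈ Set.Icc (-1) 1, 0 < radialStep p q r s ^ 2 - c := fun s hs =>
    one_pos.trans_le (one_le_sq_radialStep_sub hp hc hr hs)
  have h_int : Integrable (fun s => Real.log (radialStep p q r s ^ 2 - c)) μ :=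
    hμ.integrable_of_continuousOn (ContinuousOn.log (by fun_prop) fun s hs => (h_pos s hs).ne')
  refine (hμ.integral_le h_int
    (Real.log (r ^ 2 - c) + q ^ 2 / (r ^ 2 - c) + (p ^ 2 + q ^ 2) ^ 2 / (2 * (r ^ 2 - c) ^ 2))
    (-(p ^ 2 + q ^ 2) / (r ^ 2 - c) - 4 * c * p ^ 2 / (2 * (r ^ 2 - c) ^ 2))
    fun s hs => ?_).trans_eq (by ring)
  refine (log_sq_radialStep_sub_add_le hs hV (h_pos s hs) (h_pos _ (neg_mem_Icc hs))).trans_eq ?_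
  ring

lemma le_integral_log_radialStep (hμ : IsNoise μ v) (hp : 0 ≤ p) (hr : p < r)
    (hr' : 4 * (p ^ 2 + q ^ 2) ≤ r ^ 2) :
    Real.log r + (q ^ 2 * (1 - v) - p ^ 2 * v) / (2 * r ^ 2) - 2 * (p ^ 2 + q ^ 2) ^ 2 / r ^ 4 ≤
      ∫ s, Real.log (radialStep p q r s) ∂μ := by
  have h_pos : ∀ s ∈ Set.Icc (-1) 1, 0 < radialStep p q r s := fun s hs =>
    (sub_pos.2 hr).trans_le (sub_le_radialStep hp hs)
  have h_int : Integrable (fun s => Real.log (radialStep p q r s)) μ :=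
    hμ.integrable_of_continuousOn (ContinuousOn.log (by fun_prop) fun s hs => (h_pos s hs).ne')
  refine Eq.trans_le (by ring) (hμ.le_integral h_int
    (Real.log r + q ^ 2 / (2 * r ^ 2) - 2 * (p ^ 2 + q ^ 2) ^ 2 / r ^ 4)
    (-(p ^ 2 + q ^ 2) / (2 * r ^ 2)) fun s hs => ?_)
  refine Eq.trans_le ?_ (le_log_radialStep_add (hp.trans_lt hr) hr' hs (h_pos s hs)
    (h_pos _ (neg_mem_Icc hs)))
  ring

/- `c` is chosen to cancel the terms of order `(r ^ 2 - c)⁻²` in the drift of `log (r ^ 2 - c)`,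
which decide the sign in the critical case `q ^ 2 * (1 - v) = p ^ 2 * v`. -/
lemma exists_eventually_integral_log_sq_radialStep_sub_le (hμ : IsNoise μ v) (hv : 0 < v)
    (hp : 0 < p) (h : q ^ 2 * (1 - v) ≤ p ^ 2 * v) :
    ∃ c, ∀ᶠ r in atTop, (∀ s ∈ Set.Icc (-1) 1, 1 ≤ radialStep p q r s ^ 2 - c) ∧
      1 ≤ r ^ 2 - c ∧
      ∫ s, Real.log (radialStep p q r s ^ 2 - c) ∂μ ≤ Real.log (r ^ 2 - c) := by
  obtain ⟨c, hc, hc_mul⟩ : ∃ c, 0 ≤ c ∧ (p ^ 2 + q ^ 2) ^ 2 = 4 * c * (p ^ 2 * v) :=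
    ⟨(p ^ 2 + q ^ 2) ^ 2 / (4 * (p ^ 2 * v)), by positivity, by field_simp⟩
  refine ⟨c, ?_⟩
  filter_upwards [eventually_ge_atTop (p + c + 1)] with r hr
  have hV : 1 ≤ r ^ 2 - c := by nlinarith
  refine ⟨fun s hs => one_le_sq_radialStep_sub hp.le hc hr hs, hV, ?_⟩
  refine (hμ.integral_log_sq_radialStep_sub_le hp.le hc hr).trans ?_
  rw [hc_mul, sub_self, zero_div, add_zero, add_le_iff_nonpos_right]
  exact div_nonpos_of_nonpos_of_nonneg (sub_nonpos.2 h) (by linarith)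

end IsNoise

section PowerDrift

variable {p q r s κ : ℝ}

lemma abs_log_radialStep_sub_log_le (hp : 0 ≤ p) (hq : 0 ≤ q) (hr : 0 < r)
    (hr' : 2 * (p + q) ≤ r) (hs : s ∈ Set.Icc (-1) 1) :
    |Real.log (radialStep p q r s) - Real.log r| ≤ 2 * (p + q) / r := by
  set t := (radialStep p q r s - r) / r with ht
  have h_abs : |t| ≤ (p + q) / r := by
    rw [ht, abs_div, abs_of_pos hr]
    gcongr
    rw [abs_le]
    constructor <;> linarith [sub_le_radialStep (q := q) (r := r) hp hs,
      radialStep_le hp hq hr.le hs]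
  have h_half : |t| ≤ 1 / 2 := h_abs.trans (by rw [div_le_iff₀ hr]; linarith)
  have h_step : radialStep p q r s = r * (1 + t) := by
    rw [ht]
    field_simp
    ring
  rw [h_step, Real.log_mul hr.ne' (by linarith [(abs_le.1 h_half).1]), add_sub_cancel_left]
  calc |Real.log (1 + t)| ≤ 2 * |t| := abs_log_one_add_le h_half
    _ ≤ 2 * ((p + q) / r) := by gcongr
    _ = 2 * (p + q) / r := by ring

lemma rpow_neg_le_of_abs_log_sub_log_le {x y ε : ℝ} (hx : 0 < x) (hy : 0 < y) (hκ : 0 ≤ κ)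
    (h_log : |Real.log y - Real.log x| ≤ ε) (hκε : κ * ε ≤ 1) :
    y ^ (-κ) ≤ x ^ (-κ) * (1 - κ * (Real.log y - Real.log x) + κ ^ 2 * ε ^ 2) := by
  set l := Real.log y - Real.log x with hl
  have h_abs : |-(κ * l)| ≤ κ * ε := by
    rw [abs_neg, abs_mul, abs_of_nonneg hκ]
    gcongr
  have h_exp := (abs_le.1 (Real.abs_exp_sub_one_sub_id_le (h_abs.trans hκε))).2
  have h_sq : (-(κ * l)) ^ 2 ≤ κ ^ 2 * ε ^ 2 := by
    rw [← mul_pow]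
    exact sq_le_sq' (abs_le.1 h_abs).1 (abs_le.1 h_abs).2
  have h_eq : y ^ (-κ) = x ^ (-κ) * Real.exp (-(κ * l)) := by
    rw [Real.rpow_def_of_pos hy, Real.rpow_def_of_pos hx, ← Real.exp_add, hl]
    ring_nf
  rw [h_eq]
  gcongr
  linarith

end PowerDrift

namespace IsNoise

variable {μ : Measure ℝ} {v p q r κ : ℝ}

lemma integral_rpow_radialStep_le (hμ : IsNoise μ v) (hp : 0 ≤ p) (hq : 0 ≤ q) (hpr : p < r)
    (hr : 2 * (p + q) ≤ r) (hκ : 0 ≤ κ) (hκr : κ * (2 * (p + q) / r) ≤ 1) :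
    ∫ s, radialStep p q r s ^ (-κ) ∂μ ≤ r ^ (-κ) *
      (1 - κ * ((q ^ 2 * (1 - v) - p ^ 2 * v) / 2 - 2 * (p ^ 2 + q ^ 2) ^ 2 / r ^ 2 -
        4 * κ * (p + q) ^ 2) / r ^ 2) := by
  have := hμ.isProbabilityMeasure
  have hr_pos : 0 < r := hp.trans_lt hpr
  have h_pos : ∀ s ∈ Set.Icc (-1) 1, 0 < radialStep p q r s := fun s hs =>
    (sub_pos.2 hpr).trans_le (sub_le_radialStep hp hs)
  have h_int : Integrable (fun s => Real.log (radialStep p q r s)) μ :=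
    hμ.integrable_of_continuousOn (ContinuousOn.log (by fun_prop) fun s hs => (h_pos s hs).ne')
  have h_log : Real.log r + _ - _ ≤ _ :=
    hμ.le_integral_log_radialStep (q := q) hp hpr (by nlinarith [mul_nonneg hp hq])
  calc ∫ s, radialStep p q r s ^ (-κ) ∂μ
      ≤ ∫ s, r ^ (-κ) * (1 - κ * (Real.log (radialStep p q r s) - Real.log r) +
          κ ^ 2 * (2 * (p + q) / r) ^ 2) ∂μ := by
        refine integral_mono_of_nonneg (ae_of_all _ fun s => ?_) ?_ ?_
        · exact Real.rpow_nonneg (radialStep_nonneg _ _ _ _) _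
        · exact (((integrable_const _).sub ((h_int.sub (integrable_const _)).const_mul _)).add
            (integrable_const _)).const_mul _
        · filter_upwards [hμ.ae_mem_Icc] with s hs
          exact rpow_neg_le_of_abs_log_sub_log_le hr_pos (h_pos s hs) hκ
            (abs_log_radialStep_sub_log_le hp hq hr_pos hr hs) hκr
    _ = r ^ (-κ) * (1 - κ * (∫ s, Real.log (radialStep p q r s) ∂μ - Real.log r) +
          κ ^ 2 * (2 * (p + q) / r) ^ 2) := by
        rw [integral_const_mul, integral_add (by fun_prop) (by fun_prop),
          integral_sub (by fun_prop) (by fun_prop), integral_const_mul,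
          integral_sub h_int (by fun_prop)]
        simp
    _ ≤ _ := by
        gcongr
        rw [← sub_nonneg]
        have h_mul := mul_le_mul_of_nonneg_left h_log hκ
        have h_eq : κ ^ 2 * (2 * (p + q) / r) ^ 2 = κ * (4 * κ * (p + q) ^ 2) / r ^ 2 := by ring
        rw [h_eq]
        ring_nf at h_mul ⊢
        linarith

lemma exists_eventually_integral_rpow_radialStep_le (hμ : IsNoise μ v) (hp : 0 ≤ p) (hq : 0 < q)
    (h : p ^ 2 * v < q ^ 2 * (1 - v)) :
    ∃ κ : ℝ, 0 < κ ∧ ∀ᶠ r in atTop, ∫ s, radialStep p q r s ^ (-κ) ∂μ ≤ r ^ (-κ) := by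
  obtain ⟨κ, hκ, hκ_mul⟩ : ∃ κ : ℝ, 0 < κ ∧ 16 * κ * (p + q) ^ 2 = q ^ 2 * (1 - v) - p ^ 2 * v :=
    ⟨(q ^ 2 * (1 - v) - p ^ 2 * v) / (16 * (p + q) ^ 2),
      div_pos (sub_pos.2 h) (by positivity), by field_simp⟩
  refine ⟨κ, hκ, ?_⟩
  have h_small : Tendsto (fun r : ℝ => 2 * (p ^ 2 + q ^ 2) ^ 2 / r ^ 2) atTop (𝓝 0) :=
    tendsto_const_nhds.div_atTop (tendsto_pow_atTop two_ne_zero)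
  filter_upwards [eventually_gt_atTop p, eventually_ge_atTop (2 * (p + q)),
    eventually_ge_atTop (κ * (2 * (p + q))),
    h_small.eventually_le_const (show 0 < 4 * κ * (p + q) ^ 2 by positivity)] with r hpr hr hκr hM
  have hr_pos : 0 < r := hp.trans_lt hpr
  refine (hμ.integral_rpow_radialStep_le hp hq.le hpr hr hκ.le ?_).trans ?_
  · rwa [← mul_div_assoc, div_le_one hr_pos]
  · refine mul_le_of_le_one_right (by positivity) (sub_le_self _ (div_nonneg ?_ (sq_nonneg r)))
    exact mul_nonneg hκ.le (by linarith)

end IsNoise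

section RandomMap

variable {α β γ : Type*} [MeasurableSpace α] [MeasurableSpace β] [MeasurableSpace γ]

lemma map_id_prod_apply (η : Kernel α β) [IsSFiniteKernel η] {f : α × β → γ} (hf : Measurable f)
    (x : α) : (Kernel.id ×ₖ η).map f x = (η x).map fun y => f (x, y) := by
  rw [Kernel.map_apply _ hf, Kernel.prod_apply, Kernel.id_apply, Measure.dirac_prod,
    Measure.map_map hf measurable_prodMk_left]
  rfl

lemma IsMarkovChain.comp {Ω : Type*} [mΩ : MeasurableSpace Ω] {P : Measure Ω} [IsFiniteMeasure P]
    {ℱ : Filtration ℕ mΩ} {κ : Kernel α α} [IsSFiniteKernel κ] {κ' : Kernel β β}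
    [IsFiniteKernel κ'] {X : ℕ → Ω → α} (hX : IsMarkovChain P ℱ κ X) {f : α → β}
    (hf : Measurable f) (h : ∀ x, (κ x).map f = κ' (f x)) :
    IsMarkovChain P ℱ κ' fun n ω => f (X n ω) := by
  refine ⟨fun n => hf.comp (hX.adapted n), fun n E hE => ?_⟩
  have h_law := hX.hasCondDistrib_succ n E hE
  have hX' n : Measurable (X n) := hX.measurable n
  have hf2 : Measurable (Prod.map f f) := hf.prodMap hf
  refine ⟨by fun_prop, ?_⟩
  calc (P.restrict E).map (fun ω => (f (X n ω), f (X (n + 1) ω)))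
      = ((P.restrict E).map (X n) ⊗ₘ κ).map (Prod.map f f) := by
        rw [← h_law.map_eq, Measure.map_map hf2 (by fun_prop)]
        rfl
    _ = ((P.restrict E).map (X n)).map f ⊗ₘ κ' := by
        refine (Measure.ext_prod fun {A B} hA hB => ?_).symm
        rw [Measure.map_apply hf2 (hA.prod hB), Set.preimage_prod_map_prod,
          Measure.compProd_apply_prod (hf hA) (hf hB), Measure.compProd_apply_prod hA hB,
          setLIntegral_map hA (κ'.measurable_coe hB) hf]
        simp only [← h, Measure.map_apply hf hB]
    _ = (P.restrict E).map (fun ω => f (X n ω)) ⊗ₘ κ' := by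
        rw [Measure.map_map hf (hX' n)]
        rfl

end RandomMap

section RadialKernel

variable {p q r v : ℝ} {μ : Measure ℝ}

lemma measurable_radialStep_uncurry (p q : ℝ) :
    Measurable fun z : ℝ × ℝ => radialStep p q z.1 z.2 := by
  unfold radialStep
  fun_prop

/-- The transition kernel of the distance from the origin: the chain moves from `r` to
`radialStep p q r s`, where `s` has law `μ`. -/
noncomputable def radialKernel (p q : ℝ) (μ : Measure ℝ) : Kernel ℝ ℝ :=
  (Kernel.id ×ₖ Kernel.const ℝ μ).map fun z => radialStep p q z.1 z.2

instance [IsProbabilityMeasure μ] : IsMarkovKernel (radialKernel p q μ) :=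
  Kernel.IsMarkovKernel.map _ (measurable_radialStep_uncurry p q)

lemma radialKernel_apply [SFinite μ] (p q r : ℝ) :
    radialKernel p q μ r = μ.map (radialStep p q r) := by
  rw [radialKernel, map_id_prod_apply _ (measurable_radialStep_uncurry p q), Kernel.const_apply]

lemma integral_radialKernel [SFinite μ] {V : ℝ → ℝ} (hV : Measurable V) (p q r : ℝ) :
    ∫ y, V y ∂radialKernel p q μ r = ∫ s, V (radialStep p q r s) ∂μ := by
  rw [radialKernel_apply, integral_map (by fun_prop) hV.aestronglyMeasurable]

lemma IsNoise.ae_radialKernel_mem_Icc (hμ : IsNoise μ v) (hp : 0 ≤ p) (hq : 0 ≤ q) (hr : 0 ≤ r) :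
    ∀ᵐ y ∂radialKernel p q μ r, y ∈ Set.Icc 0 (r + (p + q)) := by
  have := hμ.isProbabilityMeasure
  rw [radialKernel_apply]
  refine (ae_map_iff (by fun_prop) measurableSet_Icc).2 ?_
  filter_upwards [hμ.ae_mem_Icc] with s hs
  exact ⟨radialStep_nonneg _ _ _ _, radialStep_le hp hq hr hs⟩

end RadialKernel

/-- `R` is a chain of distances from the origin: a Markov chain with transition kernel
`radialKernel p q μ`, where the noise `μ` has second moment `v`, and with a bounded nonnegative
initial value. -/
structure IsRadialChain {Ω : Type*} [mΩ : MeasurableSpace Ω] (P : Measure Ω)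
    (ℱ : Filtration ℕ mΩ) (p q : ℝ) (μ : Measure ℝ) (v : ℝ) (R : ℕ → Ω → ℝ) : Prop where
  isMarkovChain : IsMarkovChain P ℱ (radialKernel p q μ) R
  isNoise : IsNoise μ v
  exists_ae_zero_mem_Icc : ∃ c, ∀ᵐ ω ∂P, R 0 ω ∈ Set.Icc 0 c

namespace IsRadialChain

variable {Ω : Type*} [mΩ : MeasurableSpace Ω] {P : Measure Ω} {ℱ : Filtration ℕ mΩ}
  {p q v : ℝ} {μ : Measure ℝ} {R : ℕ → Ω → ℝ}

lemma exists_ae_mem_Icc (hR : IsRadialChain P ℱ p q μ v R) (hp : 0 ≤ p) (hq : 0 ≤ q) (n : ℕ) :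
    ∃ c, ∀ᵐ ω ∂P, R n ω ∈ Set.Icc 0 c := by
  induction n with
  | zero => exact hR.exists_ae_zero_mem_Icc
  | succ n ih =>
    obtain ⟨c, hc⟩ := ih
    refine ⟨c + (p + q), hR.isMarkovChain.ae_succ_of_ae hc measurableSet_Icc measurableSet_Icc
      fun r hr => ?_⟩
    filter_upwards [hR.isNoise.ae_radialKernel_mem_Icc hp hq hr.1] with y hy
    exact ⟨hy.1, hy.2.trans (by linarith [hr.2])⟩

lemma ae_nonneg (hR : IsRadialChain P ℱ p q μ v R) (hp : 0 ≤ p) (hq : 0 ≤ q) (n : ℕ) :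
    ∀ᵐ ω ∂P, 0 ≤ R n ω :=
  let ⟨_, hc⟩ := hR.exists_ae_mem_Icc hp hq n
  hc.mono fun _ h => h.1

lemma memLp_comp [IsFiniteMeasure P] (hR : IsRadialChain P ℱ p q μ v R) (hp : 0 ≤ p)
    (hq : 0 ≤ q) {V : ℝ → ℝ} (hV : Continuous V) (s : ℝ≥0∞) (n : ℕ) :
    MemLp (fun ω => V (R n ω)) s P := by
  obtain ⟨c, hc⟩ := hR.exists_ae_mem_Icc hp hq n
  obtain ⟨C, hC⟩ := (isCompact_Icc (a := 0) (b := c)).exists_bound_of_continuousOn hV.continuousOn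
  exact .of_bound (hV.measurable.comp (hR.isMarkovChain.measurable n)).aestronglyMeasurable C
    (hc.mono fun ω hω => hC _ hω)

lemma integrable_comp [IsFiniteMeasure P] (hR : IsRadialChain P ℱ p q μ v R) (hp : 0 ≤ p)
    (hq : 0 ≤ q) {V : ℝ → ℝ} (hV : Continuous V) (n : ℕ) : Integrable (fun ω => V (R n ω)) P :=
  memLp_one_iff_integrable.1 (hR.memLp_comp hp hq hV 1 n)

variable [IsProbabilityMeasure P]

lemma integral_sq_succ_le (hR : IsRadialChain P ℱ p q μ v R) (hp : 0 ≤ p) (hq : 0 ≤ q) (n : ℕ) :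
    ∫ ω, R (n + 1) ω ^ 2 ∂P ≤ ∫ ω, R n ω ^ 2 ∂P + (p ^ 2 * v + q ^ 2 * (1 - v)) := by
  have := hR.isNoise.isProbabilityMeasure
  have h_int := hR.integrable_comp hp hq (continuous_pow 2)
  rw [hR.isMarkovChain.integral_succ (V := fun r => r ^ 2) (by fun_prop) (h_int (n + 1))]
  calc ∫ ω, ∫ y, y ^ 2 ∂radialKernel p q μ (R n ω) ∂P
      ≤ ∫ ω, (R n ω ^ 2 + (p ^ 2 * v + q ^ 2 * (1 - v))) ∂P := by
        refine integral_mono_of_nonneg (ae_of_all _ fun ω => integral_nonneg fun y => sq_nonneg y)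
          ((h_int n).add (integrable_const _)) (ae_of_all _ fun ω => ?_)
        exact (integral_radialKernel (by fun_prop) p q _).trans_le
          (hR.isNoise.integral_sq_radialStep_le p q _)
    _ = _ := by simp [integral_add (h_int n) (integrable_const _)]

lemma integral_isBigO_sqrt (hR : IsRadialChain P ℱ p q μ v R) (hp : 0 ≤ p) (hq : 0 ≤ q) :
    (fun n => ∫ ω, R n ω ∂P) =O[atTop] fun n : ℕ => √(n : ℝ) := by
  set A := ∫ ω, R 0 ω ^ 2 ∂P
  set m := p ^ 2 * v + q ^ 2 * (1 - v)
  have h_sq (n : ℕ) : ∫ ω, R n ω ^ 2 ∂P ≤ A + n * m := by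
    induction n with
    | zero => simp [A]
    | succ n ih =>
      push_cast
      linarith [hR.integral_sq_succ_le hp hq n]
  refine .of_bound √(|A| + |m|) ?_
  filter_upwards [eventually_ge_atTop 1] with n hn
  have hn' : (1 : ℝ) ≤ n := by exact_mod_cast hn
  have h_var := variance_nonneg (R n) P
  rw [variance_eq_sub (show MemLp (R n) 2 P from hR.memLp_comp hp hq continuous_id 2 n)] at h_var
  rw [Real.norm_eq_abs, Real.norm_of_nonneg (Real.sqrt_nonneg _),
    ← Real.sqrt_mul (by positivity)]
  refine Real.abs_le_sqrt ((sub_nonneg.1 h_var).trans ((h_sq n).trans ?_))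
  nlinarith [le_abs_self A, le_abs_self m, abs_nonneg A, abs_nonneg m]

lemma measureReal_le_mul_integral_sub (hR : IsRadialChain P ℱ p q μ v R) (hp : 0 < p) (hq : 0 < q)
    (hv : v < 1) {L : ℝ} (hL : 0 ≤ L) (n : ℕ) :
    P.real {ω | R n ω ≤ L} ≤
      2 * (L + (p + q)) / (q ^ 2 * (1 - v)) * (∫ ω, R (n + 1) ω ∂P - ∫ ω, R n ω ∂P) := by
  have := hR.isNoise.isProbabilityMeasure
  have h_int n : Integrable (R n) P := hR.integrable_comp hp.le hq.le continuous_id n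
  have h_inner := hR.isMarkovChain.integrable_integral_succ (V := fun r => r) measurable_id
    (h_int (n + 1))
  have h_meas : MeasurableSet {ω | R n ω ≤ L} :=
    measurableSet_le (hR.isMarkovChain.measurable n) measurable_const
  have hδ : 0 < q ^ 2 * (1 - v) := mul_pos (by positivity) (sub_pos.2 hv)
  rw [hR.isMarkovChain.integral_succ (V := fun r => r) measurable_id (h_int (n + 1)),
    ← integral_sub h_inner (h_int n), ← integral_const_mul, ← integral_indicator_one h_meas]
  refine integral_mono_ae ((integrable_const _).indicator h_meas)
    ((h_inner.sub (h_int n)).const_mul _) ?_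
  filter_upwards [hR.ae_nonneg hp.le hq.le n] with ω hω
  have h_drift : q ^ 2 * (1 - v) / (2 * (R n ω + (p + q))) ≤
      ∫ y, y ∂radialKernel p q μ (R n ω) - R n ω := by
    rw [integral_radialKernel (V := fun r => r) measurable_id, le_sub_iff_add_le']
    exact hR.isNoise.le_integral_radialStep hp hq.le hω
  refine Set.indicator_apply_le' (fun h_le => ?_) fun _ =>
    mul_nonneg (by positivity) (le_trans (by positivity) h_drift)
  rw [Pi.one_apply, div_mul_eq_mul_div, one_le_div hδ]
  refine (div_le_iff₀' (by positivity)).1 (le_trans ?_ h_drift)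
  have h_le' : R n ω ≤ L := h_le
  gcongr

lemma ae_tendsto_sum_indicator_div (hR : IsRadialChain P ℱ p q μ v R) (hp : 0 < p) (hq : 0 < q)
    (hv : v < 1) {L : ℝ} (hL : 0 ≤ L) :
    ∀ᵐ ω ∂P, Tendsto (fun n : ℕ => (∑ k ∈ Finset.range n,
      (Set.Iic L).indicator (fun _ => (1 : ℝ)) (R k ω)) / n) atTop (𝓝 0) := by
  set K := 2 * (L + (p + q)) / (q ^ 2 * (1 - v))
  have h_meas k : MeasurableSet {ω | R k ω ≤ L} :=
    measurableSet_le (hR.isMarkovChain.measurable k) measurable_const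
  have h_nonneg k ω : 0 ≤ (Set.Iic L).indicator (fun _ => (1 : ℝ)) (R k ω) :=
    Set.indicator_nonneg (fun _ _ => zero_le_one) _
  have h_int k : Integrable (fun ω => (Set.Iic L).indicator (fun _ => (1 : ℝ)) (R k ω)) P :=
    (integrable_const (1 : ℝ)).indicator (h_meas k)
  have h_visits n : ∫ ω, ∑ k ∈ Finset.range n, (Set.Iic L).indicator (fun _ => 1) (R k ω) ∂P ≤
      K * ∫ ω, R n ω ∂P :=
    calc _ = ∑ k ∈ Finset.range n, P.real {ω | R k ω ≤ L} := by
          rw [integral_finsetSum _ fun k _ => h_int k]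
          exact Finset.sum_congr rfl fun k _ => integral_indicator_one (h_meas k)
      _ ≤ ∑ k ∈ Finset.range n, K * (∫ ω, R (k + 1) ω ∂P - ∫ ω, R k ω ∂P) :=
          Finset.sum_le_sum fun k _ => hR.measureReal_le_mul_integral_sub hp hq hv hL k
      _ = K * (∫ ω, R n ω ∂P - ∫ ω, R 0 ω ∂P) := by
          rw [← Finset.mul_sum, Finset.sum_range_sub fun k => ∫ ω, R k ω ∂P]
      _ ≤ K * ∫ ω, R n ω ∂P :=
          mul_le_mul_of_nonneg_left
            (sub_le_self _ (integral_nonneg_of_ae (hR.ae_nonneg hp.le hq.le 0)))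
            (div_nonneg (by positivity) (mul_nonneg (sq_nonneg q) (sub_nonneg.2 hv.le)))
  refine ae_tendsto_div_of_integral_isBigO_sqrt (fun n => integrable_finsetSum _ fun k _ => h_int k)
    (fun n ω => Finset.sum_nonneg fun k _ => h_nonneg k ω)
    (fun ω => monotone_nat_of_le_succ fun n => ?_) ?_
  · rw [Finset.sum_range_succ]
    exact le_add_of_nonneg_right (h_nonneg n ω)
  · refine .trans (.of_norm_le fun n => ?_) ((hR.integral_isBigO_sqrt hp.le hq.le).const_mul_left K)
    rw [Real.norm_of_nonneg (integral_nonneg fun ω => Finset.sum_nonneg fun k _ => h_nonneg k ω)]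
    exact h_visits n

end IsRadialChain

lemma neBot_inf_of_tendsto_comp {u : ℕ → ℝ} (hu : ∀ L, ∃ᶠ n in atTop, L < u n) {f : ℝ → ℝ}
    {l l' : Filter ℝ} (hf : Tendsto f atTop l) (hfu : Tendsto (fun n => f (u n)) atTop l') :
    (l ⊓ l').NeBot := by
  have h_neBot : (comap u atTop ⊓ atTop).NeBot := by
    refine inf_neBot_iff_frequently_left.2 fun {s} hs => ?_
    obtain ⟨L, hL⟩ := eventually_atTop.1 (eventually_comap.1 hs)
    exact (hu L).mono fun n hn => hL _ hn.le n rfl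
  have h_tendsto : Tendsto (fun n => f (u n)) (comap u atTop ⊓ atTop) (l ⊓ l') :=
    (hf.comp tendsto_comap).inf hfu
  exact h_tendsto.neBot

lemma IsNoise.exists_integral_max_rpow_le {p q v : ℝ} {μ : Measure ℝ} (hμ : IsNoise μ v)
    (hp : 0 ≤ p) (hq : 0 < q) (h : p ^ 2 * v < q ^ 2 * (1 - v)) :
    ∃ κ r₁ : ℝ, 0 < κ ∧ 0 < r₁ ∧
      ∀ r, ∫ s, max (radialStep p q r s) r₁ ^ (-κ) ∂μ ≤ max r r₁ ^ (-κ) := by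
  have := hμ.isProbabilityMeasure
  obtain ⟨κ, hκ, h_drift⟩ := hμ.exists_eventually_integral_rpow_radialStep_le hp hq h
  obtain ⟨r₁, hr₁⟩ := eventually_atTop.1 (h_drift.and (eventually_gt_atTop p))
  have hr₁_pos : 0 < r₁ := hp.trans_lt (hr₁ r₁ le_rfl).2
  refine ⟨κ, r₁, hκ, hr₁_pos, fun r => ?_⟩
  have h_anti {x y : ℝ} (hx : 0 < x) (hxy : x ≤ y) : y ^ (-κ) ≤ x ^ (-κ) :=
    Real.rpow_le_rpow_of_nonpos hx hxy (neg_nonpos.2 hκ.le)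
  have h_int : Integrable (fun s => max (radialStep p q r s) r₁ ^ (-κ)) μ :=
    hμ.integrable_of_continuousOn <| Continuous.continuousOn <|
      ((continuous_radialStep p q r).max continuous_const).rpow_const fun s =>
        .inl (lt_max_of_lt_right hr₁_pos).ne'
  rcases le_or_gt r r₁ with hr | hr
  · rw [max_eq_right hr]
    exact (integral_mono h_int (integrable_const _)
      fun s => h_anti hr₁_pos (le_max_right _ _)).trans_eq (by simp)
  · have h_step : ∀ s ∈ Set.Icc (-1) 1, 0 < radialStep p q r s := fun s hs =>
      (sub_pos.2 (hr₁ r hr.le).2).trans_le (sub_le_radialStep hp hs)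
    rw [max_eq_left hr.le]
    refine (integral_mono_ae h_int (hμ.integrable_of_continuousOn ?_) ?_).trans (hr₁ r hr.le).1
    · exact (continuous_radialStep p q r).continuousOn.rpow_const fun s hs =>
        .inl (h_step s hs).ne'
    · filter_upwards [hμ.ae_mem_Icc] with s hs
      exact h_anti (h_step s hs) (le_max_left _ _)

namespace IsRadialChain

variable {Ω : Type*} [mΩ : MeasurableSpace Ω] {P : Measure Ω} [IsProbabilityMeasure P]
  {ℱ : Filtration ℕ mΩ} {p q v : ℝ} {μ : Measure ℝ} {R : ℕ → Ω → ℝ}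

lemma ae_frequently_lt (hR : IsRadialChain P ℱ p q μ v R) (hp : 0 < p) (hq : 0 < q)
    (hv : v < 1) : ∀ᵐ ω ∂P, ∀ L, ∃ᶠ n in atTop, L < R n ω := by
  filter_upwards [ae_all_iff.2 fun k : ℕ => hR.ae_tendsto_sum_indicator_div hp hq hv k.cast_nonneg]
    with ω hω L h_bdd
  obtain ⟨k, hk⟩ := exists_nat_ge L
  have h_one : Tendsto (fun n => (Set.Iic (k : ℝ)).indicator (fun _ => (1 : ℝ)) (R n ω)) atTop
      (𝓝 1) := by
    refine tendsto_const_nhds.congr' (h_bdd.mono fun n hn => ?_)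
    have h_mem : R n ω ∈ Set.Iic (k : ℝ) := (not_lt.1 hn).trans hk
    exact (Set.indicator_of_mem h_mem fun _ => (1 : ℝ)).symm
  have h_cesaro := h_one.cesaro
  simp only [← div_eq_inv_mul] at h_cesaro
  exact one_ne_zero (tendsto_nhds_unique h_cesaro (hω k))

lemma ae_tendsto_atTop (hR : IsRadialChain P ℱ p q μ v R) (hp : 0 < p) (hq : 0 < q)
    (hv : v < 1) (h : p ^ 2 * v < q ^ 2 * (1 - v)) :
    ∀ᵐ ω ∂P, Tendsto (fun n => R n ω) atTop atTop := by
  have := hR.isNoise.isProbabilityMeasure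
  obtain ⟨κ, r₁, hκ, hr₁, h_drift⟩ := hR.isNoise.exists_integral_max_rpow_le hp.le hq h
  set V : ℝ → ℝ := fun r => max r r₁ ^ (-κ)
  have h_pos r : 0 < max r r₁ := lt_max_of_lt_right hr₁
  have hV_cont : Continuous V :=
    (continuous_id.max continuous_const).rpow_const fun r => .inl (h_pos r).ne'
  have hV_anti : Antitone V := fun r s hrs =>
    Real.rpow_le_rpow_of_nonpos (h_pos r) (max_le_max_right r₁ hrs) (neg_nonpos.2 hκ.le)
  have hV_drift r : ∫ y, V y ∂radialKernel p q μ r ≤ V r :=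
    (integral_radialKernel hV_cont.measurable p q r).trans_le (h_drift r)
  have hV_lim : Tendsto V atTop (𝓝 0) :=
    (tendsto_rpow_neg_atTop hκ).comp (tendsto_atTop_mono (fun r => le_max_left r r₁) tendsto_id)
  filter_upwards [hR.ae_frequently_lt hp hq hv,
    hR.isMarkovChain.ae_frequently_notMem_or_exists_tendsto hV_cont.measurable
      (fun r => (Real.rpow_pos_of_pos (h_pos r) _).le) (hR.integrable_comp hp.le hq.le hV_cont)
      MeasurableSet.univ fun r _ => hV_drift r] with ω h_unbdd h_dichotomy
  obtain ⟨c, hc⟩ := h_dichotomy.resolve_left (by simp)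
  have hc_zero : 0 = c := eq_of_nhds_neBot (neBot_inf_of_tendsto_comp h_unbdd hV_lim hc)
  refine tendsto_atTop.2 fun L => ?_
  filter_upwards [hc.eventually_lt_const (hc_zero ▸ Real.rpow_pos_of_pos (h_pos L) (-κ))]
    with n hn
  exact (hV_anti.reflect_lt hn).le

lemma exists_ae_frequently_le (hR : IsRadialChain P ℱ p q μ v R) (hp : 0 < p) (hq : 0 < q)
    (hv : 0 < v) (hv' : v < 1) (h : q ^ 2 * (1 - v) ≤ p ^ 2 * v) :
    ∃ r₁ : ℝ, ∀ᵐ ω ∂P, ∃ᶠ n in atTop, R n ω ≤ r₁ := by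
  have := hR.isNoise.isProbabilityMeasure
  obtain ⟨c, h_drift⟩ := hR.isNoise.exists_eventually_integral_log_sq_radialStep_sub_le hv hp h
  obtain ⟨r₁, hr₁⟩ := eventually_atTop.1 h_drift
  refine ⟨r₁, ?_⟩
  set V : ℝ → ℝ := fun r => Real.log (max (r ^ 2 - c) 1) with hV
  have hV_cont : Continuous V := by
    refine Continuous.log (by fun_prop) fun r => ?_
    positivity
  have hV_drift : ∀ r ∈ Set.Ioi r₁, ∫ y, V y ∂radialKernel p q μ r ≤ V r := by
    intro r hr
    obtain ⟨h_step, h_start, h_integral⟩ := hr₁ r (le_of_lt hr)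
    rw [integral_radialKernel hV_cont.measurable]
    refine (integral_congr_ae ?_).trans_le (h_integral.trans_eq ?_)
    · filter_upwards [hR.isNoise.ae_mem_Icc] with s hs
      simp only [hV, max_eq_left (h_step s hs)]
    · simp only [hV, max_eq_left h_start]
  have hV_lim : Tendsto V atTop atTop :=
    Real.tendsto_log_atTop.comp <| tendsto_atTop_mono (fun r => le_max_left (r ^ 2 - c) 1) <|
      tendsto_atTop_add_const_right _ (-c) (tendsto_pow_atTop two_ne_zero)
  filter_upwards [hR.ae_frequently_lt hp hq hv',
    hR.isMarkovChain.ae_frequently_notMem_or_exists_tendsto hV_cont.measurable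
      (fun r => Real.log_nonneg (le_max_right _ _)) (hR.integrable_comp hp.le hq.le hV_cont)
      measurableSet_Ioi hV_drift] with ω h_unbdd h_dichotomy
  refine (h_dichotomy.resolve_right ?_).mono fun n hn => not_lt.1 hn
  rintro ⟨l, hl⟩
  exact (neBot_inf_of_tendsto_comp h_unbdd hV_lim hl).ne (disjoint_nhds_atTop l).symm.eq_bot

end IsRadialChain

/-! ### The uniform distribution on the sphere -/

section SphereLaw

open scoped Pointwise

variable {d : ℕ}

/-- The uniform distribution on the unit sphere, as a measure on the ambient space. -/
noncomputable def sphereLaw (d : ℕ) : Measure (Vec d) :=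
  (uniformSphere d).map Subtype.val

lemma sphereLaw_apply {B : Set (Vec d)} (hB : MeasurableSet B) :
    sphereLaw d B = ((volume : Measure (Vec d)).toSphere Set.univ)⁻¹ *
      (Module.finrank ℝ (Vec d) * (volume : Measure (Vec d))
        (Set.Ioo (0 : ℝ) 1 • (B ∩ Metric.sphere 0 1))) := by
  rw [sphereLaw, Measure.map_apply measurable_subtype_coe hB, uniformSphere, Measure.smul_apply,
    Measure.toSphere_apply' _ (measurable_subtype_coe hB), Subtype.image_preimage_coe,
    Set.inter_comm, smul_eq_mul]

instance [NeZero d] : IsProbabilityMeasure (uniformSphere d) := by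
  refine ⟨ENNReal.inv_mul_cancel ?_ (measure_ne_top _ _)⟩
  rw [Ne, Measure.measure_univ_eq_zero]
  exact Measure.toSphere_ne_zero _

instance [NeZero d] : IsProbabilityMeasure (sphereLaw d) :=
  Measure.isProbabilityMeasure_map measurable_subtype_coe.aemeasurable

lemma ae_norm_eq_one_sphereLaw (d : ℕ) : ∀ᵐ ζ ∂sphereLaw d, ‖ζ‖ = 1 := by
  rw [sphereLaw, ae_map_iff measurable_subtype_coe.aemeasurable
    (measurableSet_eq_fun measurable_norm measurable_const)]
  exact ae_of_all _ norm_eq_of_mem_sphere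

lemma Ioo_smul_preimage_inter_sphere (e : Vec d ≃ₗᵢ[ℝ] Vec d) (B : Set (Vec d)) :
    Set.Ioo (0 : ℝ) 1 • (e ⁻¹' B ∩ Metric.sphere 0 1) =
      e ⁻¹' (Set.Ioo (0 : ℝ) 1 • (B ∩ Metric.sphere 0 1)) := by
  have h_inter : e ⁻¹' B ∩ Metric.sphere 0 1 = e.symm '' (B ∩ Metric.sphere 0 1) := by
    simp [LinearIsometryEquiv.image_eq_preimage_symm, Set.preimage_inter]
  rw [h_inter, ← e.symm_symm, ← e.symm.image_eq_preimage_symm, e.symm_symm]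
  exact (Set.image_image2_distrib_right fun r y => e.symm.map_smul r y).symm

lemma sphereLaw_map_isometry (e : Vec d ≃ₗᵢ[ℝ] Vec d) : (sphereLaw d).map e = sphereLaw d := by
  have he : Measurable e := e.continuous.measurable
  ext B hB
  rw [Measure.map_apply he hB, sphereLaw_apply hB, sphereLaw_apply (he hB),
    Ioo_smul_preimage_inter_sphere]
  congr 2
  exact e.measurePreserving.measure_preimage_equiv (f := e.toMeasurableEquiv) _

/-- The law of one coordinate of a uniform point of the unit sphere. -/
noncomputable def coordLaw (d : ℕ) : Measure ℝ :=
  (sphereLaw d).map fun ζ => inner ℝ ζ (e₁ d)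

instance [NeZero d] : IsProbabilityMeasure (coordLaw d) :=
  Measure.isProbabilityMeasure_map (by fun_prop)

variable [NeZero d]

lemma e₁_eq_single : e₁ d = EuclideanSpace.single 0 1 := by
  ext i
  simp [e₁, Fin.val_eq_zero_iff]

lemma norm_e₁ : ‖e₁ d‖ = 1 := by
  simp [e₁_eq_single]

lemma sphereLaw_map_inner {u : Vec d} (hu : ‖u‖ = 1) :
    (sphereLaw d).map (fun ζ => inner ℝ ζ u) = coordLaw d := by
  set e : Vec d ≃ₗᵢ[ℝ] Vec d := (ℝ ∙ (e₁ d - u))ᗮ.reflection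
  have he : e (e₁ d) = u := Submodule.reflection_sub (norm_e₁.trans hu.symm)
  rw [← sphereLaw_map_isometry e, Measure.map_map (by fun_prop) e.continuous.measurable, coordLaw]
  simp only [Function.comp_def, ← he, e.inner_map_map]

instance : (coordLaw d).IsNegInvariant where
  neg_eq_self := by
    have h_neg := sphereLaw_map_inner ((norm_neg _).trans (norm_e₁ (d := d)))
    simp only [inner_neg_right] at h_neg
    rw [Measure.neg]
    nth_rw 1 [coordLaw]
    rwa [Measure.map_map measurable_neg (by fun_prop)]

lemma sphereLaw_map_apply (i : Fin d) : (sphereLaw d).map (fun ζ => ζ i) = coordLaw d := by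
  have h_single : ‖(EuclideanSpace.single i 1 : Vec d)‖ = 1 := by simp
  simpa [EuclideanSpace.inner_single_right] using sphereLaw_map_inner h_single

lemma ae_coordLaw_mem_Icc : ∀ᵐ s ∂coordLaw d, s ∈ Set.Icc (-1) 1 := by
  refine (ae_map_iff (by fun_prop) measurableSet_Icc).2 ?_
  filter_upwards [ae_norm_eq_one_sphereLaw d] with ζ hζ
  simpa [hζ, norm_e₁, abs_le] using abs_real_inner_le_norm ζ (e₁ d)

lemma integral_sq_coordLaw : ∫ s, s ^ 2 ∂coordLaw d = 1 / d := by
  have h_coord (i : Fin d) : ∫ ζ, ζ i ^ 2 ∂sphereLaw d = ∫ s, s ^ 2 ∂coordLaw d := by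
    rw [← sphereLaw_map_apply i, integral_map (by fun_prop) (by fun_prop)]
  have h_int (i : Fin d) : Integrable (fun ζ => ζ i ^ 2) (sphereLaw d) := by
    refine .of_bound (by fun_prop) 1 ?_
    filter_upwards [ae_norm_eq_one_sphereLaw d] with ζ hζ
    rw [norm_pow]
    exact pow_le_one₀ (norm_nonneg _) ((PiLp.norm_apply_le ζ i).trans_eq hζ)
  have h_sum : ∑ i, ∫ ζ, ζ i ^ 2 ∂sphereLaw d = 1 := by
    rw [← integral_finsetSum _ fun i _ => h_int i]
    have h_norm : (fun ζ => ∑ i, ζ i ^ 2) =ᵐ[sphereLaw d] fun _ => (1 : ℝ) := by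
      filter_upwards [ae_norm_eq_one_sphereLaw d] with ζ hζ
      rw [← EuclideanSpace.real_norm_sq_eq, hζ, one_pow]
    simp [integral_congr_ae h_norm]
  simp only [h_coord, Finset.sum_const, Finset.card_univ, Fintype.card_fin, nsmul_eq_mul] at h_sum
  exact eq_one_div_of_mul_eq_one_right h_sum

lemma isNoise_coordLaw (d : ℕ) [NeZero d] : IsNoise (coordLaw d) (1 / d) :=
  ⟨inferInstance, inferInstance, ae_coordLaw_mem_Icc, integral_sq_coordLaw⟩

end SphereLaw

/-! ### The distance of the walk from the origin -/

section Increment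

variable {d : ℕ} {p q : ℝ} {u ζ : Vec d}

/-- The image of `ζ` under the linear map that multiplies the unit vector `u` by `p` and its
orthogonal complement by `q`. -/
noncomputable def stretch (p q : ℝ) (u ζ : Vec d) : Vec d :=
  q • ζ + ((p - q) * inner ℝ ζ u) • u

@[fun_prop]
lemma measurable_stretch (p q : ℝ) (u : Vec d) : Measurable (stretch p q u) := by
  unfold stretch
  fun_prop

lemma map_stretch (e : Vec d ≃ₗᵢ[ℝ] Vec d) (p q : ℝ) (u ζ : Vec d) :
    e (stretch p q u ζ) = stretch p q (e u) (e ζ) := by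
  simp only [stretch, map_add, map_smul, e.inner_map_map]

lemma norm_smul_add_stretch_sq (hu : ‖u‖ = 1) (hζ : ‖ζ‖ = 1) (p q r : ℝ) :
    ‖r • u + stretch p q u ζ‖ ^ 2 =
      (r + p * inner ℝ ζ u) ^ 2 + q ^ 2 * (1 - inner ℝ ζ u ^ 2) := by
  have h_split : r • u + stretch p q u ζ = (r + (p - q) * inner ℝ ζ u) • u + q • ζ := by
    rw [stretch, add_smul]
    abel
  rw [h_split, norm_add_sq_real, norm_smul, norm_smul, hu, hζ, real_inner_smul_left,
    real_inner_smul_right, real_inner_comm, mul_one, mul_one, Real.norm_eq_abs, Real.norm_eq_abs,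
    sq_abs, sq_abs]
  ring

lemma norm_smul_direction (x : Vec d) : ‖x‖ • direction x = x := by
  unfold direction
  split_ifs with h
  · simp [h]
  · rw [smul_smul, mul_inv_cancel₀ (norm_ne_zero_iff.2 h), one_smul]

@[fun_prop]
lemma measurable_direction : Measurable (direction : Vec d → Vec d) :=
  .ite (measurableSet_singleton 0) measurable_const (by fun_prop)

lemma exists_isometry_eq_toEuclideanLin {M : Matrix (Fin d) (Fin d) ℝ}
    (hM : M ∈ Matrix.orthogonalGroup (Fin d) ℝ) :
    ∃ e : Vec d ≃ₗᵢ[ℝ] Vec d, ∀ ζ, e ζ = Matrix.toEuclideanLin M ζ :=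
  ⟨Unitary.linearIsometryEquiv
    ⟨Matrix.toEuclideanCLM (n := Fin d) (𝕜 := ℝ) M, Unitary.map_mem _ hM⟩, fun _ => rfl⟩

lemma measurable_stretch_direction (p q : ℝ) :
    Measurable fun z : Vec d × Vec d => stretch p q (direction z.1) z.2 := by
  unfold stretch
  fun_prop

variable [NeZero d]

lemma norm_direction (x : Vec d) : ‖direction x‖ = 1 := by
  unfold direction
  split_ifs with h
  · exact norm_e₁
  · rw [norm_smul, norm_inv, norm_norm, inv_mul_cancel₀ (norm_ne_zero_iff.2 h)]

lemma norm_add_stretch_direction (p q : ℝ) (x : Vec d) (hζ : ‖ζ‖ = 1) :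
    ‖x + stretch p q (direction x) ζ‖ = radialStep p q ‖x‖ (inner ℝ ζ (direction x)) := by
  rw [radialStep, ← norm_smul_add_stretch_sq (norm_direction x) hζ, norm_smul_direction,
    Real.sqrt_sq (norm_nonneg _)]

lemma toEuclideanLin_axesMatrix (a b : ℝ) (ζ : Vec d) :
    Matrix.toEuclideanLin (axesMatrix d a b) ζ = stretch (√d * a) (√d * b) (e₁ d) ζ := by
  ext i
  rw [axesMatrix, stretch, e₁_eq_single, EuclideanSpace.inner_single_right]
  rcases eq_or_ne i 0 with rfl | hi
  · simp only [Fin.val_eq_zero_iff, map_smul, LinearMap.smul_apply, Matrix.toLpLin_apply,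
      PiLp.smul_apply, Matrix.mulVec_diagonal, ↓reduceIte, smul_eq_mul, Real.ringHom_apply,
      one_mul, PiLp.add_apply, PiLp.single_eq_same, mul_one]
    ring
  · simp [Matrix.toLpLin_apply, Matrix.mulVec_diagonal, hi, mul_assoc]

lemma incrementLaw_eq_map_stretch {Q : Vec d → Matrix (Fin d) (Fin d) ℝ} (hQ : IsFrame Q)
    (a b : ℝ) (x : Vec d) :
    incrementLaw a b Q x =
      (sphereLaw d).map (stretch (√d * a) (√d * b) (direction x)) := by
  obtain ⟨h_orthogonal, h_frame⟩ := hQ _ (norm_direction x)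
  obtain ⟨e, he⟩ := exists_isometry_eq_toEuclideanLin h_orthogonal
  have h_apply (ζ : Vec d) : Matrix.toEuclideanLin (Q (direction x) * axesMatrix d a b) ζ =
      stretch (√d * a) (√d * b) (direction x) (e ζ) :=
    calc _ = e (Matrix.toEuclideanLin (axesMatrix d a b) ζ) := by
          rw [he]
          simp [Matrix.toLpLin_apply, Matrix.mulVec_mulVec]
      _ = _ := by rw [toEuclideanLin_axesMatrix, map_stretch, he (e₁ d), h_frame]
  have he_meas : Measurable e := e.continuous.measurable
  rw [← sphereLaw_map_isometry e, Measure.map_map (by fun_prop) he_meas, sphereLaw,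
    Measure.map_map (by fun_prop) measurable_subtype_coe, incrementLaw]
  simp only [h_apply, Function.comp_def]

/-- The law of the increments of the walk, with semi-axes `p` (radially) and `q` (across), as a
function of the position. -/
noncomputable def incrementKernel (d : ℕ) (p q : ℝ) : Kernel (Vec d) (Vec d) :=
  (Kernel.id ×ₖ Kernel.const _ (sphereLaw d)).map fun z => stretch p q (direction z.1) z.2

instance : IsMarkovKernel (incrementKernel d p q) :=
  Kernel.IsMarkovKernel.map _ (measurable_stretch_direction p q)

lemma incrementKernel_apply (p q : ℝ) (x : Vec d) :
    incrementKernel d p q x = (sphereLaw d).map (stretch p q (direction x)) := by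
  rw [incrementKernel, map_id_prod_apply _ (measurable_stretch_direction p q), Kernel.const_apply]

lemma map_norm_map_add_incrementKernel (p q : ℝ) (x : Vec d) :
    (((Kernel.id ×ₖ incrementKernel d p q).map fun z => z.1 + z.2) x).map norm =
      radialKernel p q (coordLaw d) ‖x‖ := by
  calc _ = (sphereLaw d).map fun ζ => ‖x + stretch p q (direction x) ζ‖ := by
        rw [map_id_prod_apply _ (by fun_prop), incrementKernel_apply,
          Measure.map_map (by fun_prop) (by fun_prop), Measure.map_map (by fun_prop) (by fun_prop)]
        rfl
    _ = (sphereLaw d).map fun ζ => radialStep p q ‖x‖ (inner ℝ ζ (direction x)) :=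
        Measure.map_congr <| (ae_norm_eq_one_sphereLaw d).mono fun ζ hζ =>
          norm_add_stretch_direction p q x hζ
    _ = radialKernel p q (coordLaw d) ‖x‖ := by
        rw [radialKernel_apply, ← sphereLaw_map_inner (norm_direction x),
          Measure.map_map (by fun_prop) (by fun_prop)]
        rfl

end Increment

section Occupation

variable {Ω : Type*} {d : ℕ} {A : Set (Vec d)} {L : ℝ}

lemma occupation_nonneg (X : ℕ → Ω → Vec d) (A : Set (Vec d)) (n : ℕ) (ω : Ω) :
    0 ≤ occupation X A n ω :=
  mul_nonneg (by positivity)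
    (Finset.sum_nonneg fun _ _ => Set.indicator_nonneg (fun _ _ => zero_le_one) _)

lemma occupation_mono (X : ℕ → Ω → Vec d) {B : Set (Vec d)} (hAB : A ⊆ B) (n : ℕ) (ω : Ω) :
    occupation X A n ω ≤ occupation X B n ω :=
  mul_le_mul_of_nonneg_left (Finset.sum_le_sum fun _ _ =>
    Set.indicator_le_indicator_of_subset hAB (fun _ => zero_le_one) _) (by positivity)

lemma occupation_le_one (X : ℕ → Ω → Vec d) (A : Set (Vec d)) (n : ℕ) (ω : Ω) :
    occupation X A n ω ≤ 1 := by
  rw [occupation, one_div_mul_eq_div]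
  refine div_le_one_of_le₀ ?_ n.cast_nonneg
  refine (Finset.sum_le_card_nsmul _ _ 1 fun k _ => ?_).trans_eq (by simp)
  exact Set.indicator_le_self' (fun _ _ => zero_le_one) _

lemma occupation_closedBall (X : ℕ → Ω → Vec d) (L : ℝ) (n : ℕ) (ω : Ω) :
    occupation X (Metric.closedBall 0 L) n ω =
      (∑ k ∈ Finset.range n, (Set.Iic L).indicator (fun _ => (1 : ℝ)) ‖X k ω‖) / n := by
  have h_ball : Metric.closedBall (0 : Vec d) L = norm ⁻¹' Set.Iic L := by
    ext x
    simp
  rw [occupation, one_div_mul_eq_div, h_ball]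
  rfl

variable [MeasurableSpace Ω]

lemma measurable_occupation {X : ℕ → Ω → Vec d} (hX : ∀ n, Measurable (X n))
    (hA : MeasurableSet A) (n : ℕ) : Measurable (occupation X A n) :=
  (Finset.measurable_sum _ fun k _ => (measurable_const.indicator hA).comp (hX k)).const_mul _

lemma tendsto_eLpNorm_zero_of_ae_tendsto_zero {P : Measure Ω} [IsFiniteMeasure P] {f : ℕ → Ω → ℝ}
    (hf : ∀ n, AEStronglyMeasurable (f n) P) {C : ℝ} (h_bound : ∀ n ω, ‖f n ω‖ ≤ C)
    (h : ∀ᵐ ω ∂P, Tendsto (fun n => f n ω) atTop (𝓝 0)) {s : ℝ≥0∞} (hs : 1 ≤ s) (hs' : s ≠ ∞) :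
    Tendsto (fun n => eLpNorm (f n) s P) atTop (𝓝 0) := by
  have h_unif : UnifIntegrable f s P := by
    refine unifIntegrable_of hs hs' hf fun ε _ => ⟨C.toNNReal + 1, fun n => ?_⟩
    have h_empty : {ω | C.toNNReal + 1 ≤ ‖f n ω‖₊} = ∅ := by
      refine Set.eq_empty_of_forall_notMem fun ω hω => ?_
      have h_lt : C < ‖f n ω‖ := C.le_coe_toNNReal.trans_lt (lt_of_lt_of_le (lt_add_one _) hω)
      exact h_lt.not_ge (h_bound n ω)
    simp [h_empty]
  simpa using tendsto_Lp_finite_of_tendsto_ae hs hs' hf MemLp.zero h_unif h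

lemma isNull_of_forall_closedBall {P : Measure Ω} [IsFiniteMeasure P] {X : ℕ → Ω → Vec d}
    (hX : ∀ n, Measurable (X n))
    (h : ∀ L : ℝ, 0 ≤ L →
      ∀ᵐ ω ∂P, Tendsto (fun n => occupation X (Metric.closedBall 0 L) n ω) atTop (𝓝 0)) :
    IsNull P X := by
  intro A hA
  obtain ⟨L, hL, hAL⟩ := hA.subset_closedBall_lt 0 0
  have h_le n ω := occupation_mono X hAL n ω
  refine ⟨?_, fun s hs => ?_⟩
  · filter_upwards [h L hL.le] with ω hω
    exact squeeze_zero (fun n => occupation_nonneg X A n ω) (fun n => h_le n ω) hω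
  · have h_ball : Tendsto (fun n => eLpNorm (occupation X (Metric.closedBall 0 L) n)
        (ENNReal.ofReal s) P) atTop (𝓝 0) :=
      tendsto_eLpNorm_zero_of_ae_tendsto_zero
        (fun n => (measurable_occupation hX measurableSet_closedBall n).aestronglyMeasurable)
        (fun n ω => (Real.norm_of_nonneg (occupation_nonneg X _ n ω)).trans_le
          (occupation_le_one X _ n ω))
        (h L hL.le) (ENNReal.one_le_ofReal.2 hs) ENNReal.ofReal_ne_top
    refine tendsto_of_tendsto_of_tendsto_of_le_of_le tendsto_const_nhds h_ball
      (fun n => zero_le) fun n => eLpNorm_mono_real fun ω => ?_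
    rw [Real.norm_of_nonneg (occupation_nonneg X A n ω)]
    exact h_le n ω

end Occupation

lemma isRecurrent_of_ae_frequently_norm_le {Ω : Type*} [MeasurableSpace Ω] {P : Measure Ω} {d : ℕ}
    {X : ℕ → Ω → Vec d} {r : ℝ} (h : ∀ᵐ ω ∂P, ∃ᶠ n in atTop, ‖X n ω‖ ≤ r) :
    IsRecurrent P X := by
  refine ⟨r.toNNReal, h.mono fun ω hω => liminf_le_of_frequently_le' (hω.mono fun n hn => ?_)⟩
  rw [← ofReal_norm]
  exact ENNReal.ofReal_le_ofReal hn

lemma IsEllipticWalk.isRadialChain {Ω : Type*} [MeasurableSpace Ω] {P : Measure Ω}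
    [IsProbabilityMeasure P] {d : ℕ} [NeZero d] {a b : ℝ} {Q : Vec d → Matrix (Fin d) (Fin d) ℝ}
    (hQ : IsFrame Q) {x₀ : Vec d} {X : ℕ → Ω → Vec d} (hX : IsEllipticWalk P a b Q x₀ X) :
    IsRadialChain P (Filtration.natural X fun n => (hX.measurable n).stronglyMeasurable)
      (√d * a) (√d * b) (coordLaw d) (1 / d) fun n ω => ‖X n ω‖ where
  isMarkovChain := by
    have h_sm n : StronglyMeasurable (X n) := (hX.measurable n).stronglyMeasurable
    refine (isMarkovChain_of_condExp_increment (η := incrementKernel d (√d * a) (√d * b))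
      (fun n => (Filtration.stronglyAdapted_natural h_sm n).measurable) fun n B hB => ?_).comp
      measurable_norm (map_norm_map_add_incrementKernel _ _)
    simpa only [incrementKernel_apply, ← incrementLaw_eq_map_stretch hQ] using hX.increment n B hB
  isNoise := isNoise_coordLaw d
  exists_ae_zero_mem_Icc :=
    ⟨‖x₀‖, hX.start.mono fun ω hω => ⟨norm_nonneg _, (congrArg norm hω).le⟩⟩

end EllipticWalk

theorem mainTheorem3 {Ω : Type*} [MeasurableSpace Ω] (P : Measure Ω) [IsProbabilityMeasure P]
    (d : ℕ) (hd : 2 ≤ d) (a b : ℝ) (ha : 0 < a) (hb : 0 < b)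
    (Q : EllipticWalk.Vec d → Matrix (Fin d) (Fin d) ℝ) (hQ : EllipticWalk.IsFrame Q)
    (x₀ : EllipticWalk.Vec d) (X : ℕ → Ω → EllipticWalk.Vec d)
    (hX : EllipticWalk.IsEllipticWalk P a b Q x₀ X) :
    (a ^ 2 < ((d : ℝ) - 1) * b ^ 2 → EllipticWalk.IsTransient P X) ∧
    (((d : ℝ) - 1) * b ^ 2 ≤ a ^ 2 → EllipticWalk.IsNullRecurrent P X) := by
  have hd0 : (0 : ℝ) < d := by positivity
  have : NeZero d := ⟨by lia⟩
  have hv0 : (0 : ℝ) < 1 / d := by positivity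
  have hv1 : (1 : ℝ) / d < 1 := (div_lt_one hd0).2 (by exact_mod_cast hd)
  have hp : 0 < √(d : ℝ) * a := by positivity
  have hq : 0 < √(d : ℝ) * b := by positivity
  have h_radial : (√(d : ℝ) * a) ^ 2 * (1 / d) = a ^ 2 := by
    rw [mul_pow, Real.sq_sqrt hd0.le]
    field_simp
  have h_transversal : (√(d : ℝ) * b) ^ 2 * (1 - 1 / d) = ((d : ℝ) - 1) * b ^ 2 := by
    rw [mul_pow, Real.sq_sqrt hd0.le]
    field_simp
  have hR := hX.isRadialChain hQ
  rw [← h_radial, ← h_transversal]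
  refine ⟨fun h => hR.ae_tendsto_atTop hp hq hv1 h, fun h => ⟨?_, ?_⟩⟩
  · obtain ⟨r₁, hr₁⟩ := hR.exists_ae_frequently_le hp hq hv0 hv1 h
    exact EllipticWalk.isRecurrent_of_ae_frequently_norm_le hr₁
  · refine EllipticWalk.isNull_of_forall_closedBall hX.measurable fun L hL => ?_
    simpa only [EllipticWalk.occupation_closedBall] using
      hR.ae_tendsto_sum_indicator_div hp hq hv1 hL
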